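/- **Square min-sum bin packing.** An instance $I$ is a list of $n$ square items with sizes (side lengths) $s_1,\dots,s_n\in(0,1]$. A feasible packing places every item, with sides parallel to the axes, in one of the unit square bins $B_1,B_2,\dots,B_m$, inside the bin and so that the interiors of any two items in the same bin are disjoint. Its cost is $\sum_j j\cdot|B_j|$, where $|B_j|$ is the number of items in $B_j$. Let $\mathrm{OPT}(I)$ be the minimum cost of a feasible packing of $I$. **Algorithm.** 1. Sort all items in non-decreasing order of size and divide them into consecutive groups $G_1,\dots,G_q$: each group receives items until its total area exceeds $1$ or no items are left. Let $G_1,\dots,G_r$ be the groups that contain only small items (size $\le 1/3$), and let $G^S_{r+1}$ be the set of small items of $G_{r+1}$. For $G_1,\dots,G_r,G^S_{r+1}$ in this order, pack the items of the group into new bins with Next Fit Decreasing Height (NFDH): items are taken in non-increasing order of size and put from left to right in the current level; an item that does not fit there opens a new level directly above the current one (the height of a level is the size of its first item); if the new level does not fit in the current bin, it is opened at the bottom of a new bin. 2. Pack the items of size $>1/3$ with First Fit Decreasing Size (FFDS): the items of size $>1/2$ are placed, in non-decreasing order of size, one per bin in the bottom left corner. The remaining items are listed in non-increasing order of size. As long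 as the list is non-empty: if its first item fits in a bin already opened (next to the single item in that bin), then the first three items of the list (or all of them, if fewer remain) are packed in the first such bin, one in each unoccupied corner; otherwise a new bin is opened and the first four items of the list (or all of them, if fewer remain) are packed in it, one in each corner. 3. Sort the bins of step 2 in non-increasing order of their number of items, and place them after the bins of step 1. Let $A(I)$ be the cost of the packing that the algorithm returns. **Theorem.** The algorithm returns a feasible packing for every instance $I$. For every instance $I$ with $n\ge 266730$ items, $$A(I) < \tfrac{53}{22}\,\mathrm{OPT}(I).$$ Moreover, the algorithm has an implementation with running time $O(n\log n)$: in a step-counting model in which each function call and each comparison or arithmetic operation on numbers costs one step, there are an explicit list-based implementation that returns exactly the packing described above and a constant $C$ such that the implementation takes at most $C\,n\log n$ steps on every instance with $n\ge 2$ items. In this sense the algorithm is an $O(n\log n)$ $\frac{53}{22}$-approximation for instances with $n\geq 266730$. -/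

import Mathlib

namespace SquareMinSum

noncomputable section

/-! ### The square min-sum bin packing problem -/

/-- An axis-parallel square of side `size` whose lower left corner is at `(x, y)`. -/
structure PlacedSquare where
  size : ℝ
  x : ℝ
  y : ℝ

/-- The points of a placed square. -/
def PlacedSquare.region (p : PlacedSquare) : Set (ℝ × ℝ) :=
  Set.Icc p.x (p.x + p.size) ×ˢ Set.Icc p.y (p.y + p.size)

/-- The internal area of a placed square. -/
def PlacedSquare.internal (p : PlacedSquare) : Set (ℝ × ℝ) :=
  Set.Ioo p.x (p.x + p.size) ×ˢ Set.Ioo p.y (p.y + p.size)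

/-- The content of one bin: the placed squares it holds (their order is irrelevant). -/
abbrev Bin := List PlacedSquare

/-- A bin is packed feasibly if all its squares lie in the unit square and no two of them overlap
in their internal areas. -/
def FeasibleBin (B : Bin) : Prop :=
  (∀ p ∈ B, p.region ⊆ Set.Icc (0 : ℝ) 1 ×ˢ Set.Icc (0 : ℝ) 1) ∧
    B.Pairwise fun p q => Disjoint p.internal q.internal

/-- An instance is the list of the sizes of its items, all of them in `(0, 1]`. -/
def IsInstance (I : List ℝ) : Prop := ∀ s ∈ I, 0 < s ∧ s ≤ 1

/-- `P = [B₁, …, Bₘ]` is a feasible packing of the instance `I`: every bin is feasible, and the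
bins together hold exactly the items of `I`, with multiplicities. -/
def IsPacking (I : List ℝ) (P : List Bin) : Prop :=
  (∀ B ∈ P, FeasibleBin B) ∧ (P.flatten.map PlacedSquare.size).Perm I

/-- The cost `∑ⱼ j · |Bⱼ|` of a packing `[B₁, …, Bₘ]` (bins are numbered from `1`). -/
def cost (P : List Bin) : ℕ := ∑ j : Fin P.length, (j.val + 1) * (P.get j).length

/-- The minimum cost of a feasible packing of `I`. -/
def OPT (I : List ℝ) : ℕ := sInf {c : ℕ | ∃ P : List Bin, IsPacking I P ∧ cost P = c}

/-! ### The algorithm -/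

/-- The items in non-decreasing order of size. -/
def sortUp (L : List ℝ) : List ℝ := L.mergeSort fun a b => decide (a ≤ b)

/-- The items in non-increasing order of size. -/
def sortDown (L : List ℝ) : List ℝ := L.mergeSort fun a b => decide (b ≤ a)

/-- The total area of a collection of items. -/
def area (C : List ℝ) : ℝ := (C.map fun s => s ^ 2).sum

/-- Divide a list of items into groups: the current group `G` receives items until its area
exceeds `1` or no items are left. -/
def groupsFrom (G : List ℝ) : List ℝ → List (List ℝ)
  | [] => match G with
    | [] => []
    | a :: G' => [a :: G']
  | s :: rest =>
    if 1 < area (s :: G) then (s :: G) :: groupsFrom [] rest else groupsFrom (s :: G) rest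

/-- The groups `G₁, …, G_q` of the instance `I`. -/
def groups (I : List ℝ) : List (List ℝ) := groupsFrom [] (sortUp I)

/-- The next-fit rule with levels. The current bin holds `B`; its current (topmost) level has its
bottom at `y`, has height `h`, and is filled up to width `w`. An item goes to the current level if
it fits there, else it opens a new level in the current bin if that fits, else it opens a new
bin. -/
def nextFitLevels (B : Bin) (y h w : ℝ) : List ℝ → List Bin
  | [] => [B]
  | s :: rest =>
    if w + s ≤ 1 then nextFitLevels (⟨s, w, y⟩ :: B) y h (w + s) rest
    else if y + h + s ≤ 1 then nextFitLevels (⟨s, 0, y + h⟩ :: B) (y + h) s s rest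
    else B :: nextFitLevels [⟨s, 0, 0⟩] 0 s s rest

/-- `nextFitLevels` started with an empty list of bins. -/
def nextFitStart : List ℝ → List Bin
  | [] => []
  | s :: rest => nextFitLevels [⟨s, 0, 0⟩] 0 s s rest

/-- Next Fit Decreasing Height. -/
def NFDH (L : List ℝ) : List Bin := nextFitStart (sortDown L)

/-- The small items of each group are packed with NFDH into new bins, group after group. (The
groups are in non-decreasing order of size, so the small items of a group are the whole group for
`G₁, …, G_r`, the part `G^S_{r+1}` for `G_{r+1}`, and none for the later groups.) -/
def packSmall (I : List ℝ) : List Bin :=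
  (groups I).flatMap fun G => NFDH (G.filter fun s => decide (s ≤ 1 / 3))

/-- Placing an item in a given corner of a bin. -/
def bottomLeft (s : ℝ) : PlacedSquare := ⟨s, 0, 0⟩
def bottomRight (s : ℝ) : PlacedSquare := ⟨s, 1 - s, 0⟩
def topLeft (s : ℝ) : PlacedSquare := ⟨s, 0, 1 - s⟩
def topRight (s : ℝ) : PlacedSquare := ⟨s, 1 - s, 1 - s⟩

/-- The bin that receives the first four of the given items, one in each corner. -/
def fourCorners (L : List ℝ) : Bin :=
  List.zipWith (fun c s => c s) [bottomLeft, bottomRight, topLeft, topRight] L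

/-- The placement of the first three of the given items in the corners other than the bottom
left one. -/
def threeCorners (L : List ℝ) : Bin :=
  List.zipWith (fun c s => c s) [bottomRight, topLeft, topRight] L

open Classical in
/-- Whether an item of size `m ∈ (1/3, 1/2]` fits in an open bin of FFDS: the bin holds just one
item (in its bottom left corner) and the sizes add up to at most `1`. While items remain to be
packed, an open bin with more than one item has all its corners occupied. -/
def fitsIn (m : ℝ) (B : Bin) : Bool := decide (∃ p : PlacedSquare, B = [p] ∧ p.size + m ≤ 1)

/-- The main loop of FFDS, on the list of the open bins and the list of the medium items that
remain: if the first item fits in an open bin, then the first three items are packed in the first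
bin where it fits; else the first four items are packed in a new bin. -/
def ffdsLoop (bins : List Bin) : List ℝ → List Bin
  | [] => bins
  | m :: ms =>
    match bins.findIdx? (fitsIn m) with
    | some i => ffdsLoop (bins.modify i fun B => B ++ threeCorners (m :: ms)) (ms.drop 2)
    | none => ffdsLoop (bins ++ [fourCorners (m :: ms)]) (ms.drop 3)
termination_by L => L.length
decreasing_by all_goals (simp only [List.length_drop, List.length_cons]; omega)

/-- First Fit Decreasing Size, on items of size greater than `1/3`: items greater than `1/2` are
placed in non-decreasing order in the bottom left corner of one bin each, then the other items are
packed in non-increasing order. -/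
def FFDS (L : List ℝ) : List Bin :=
  ffdsLoop ((sortUp (L.filter fun s => decide (1 / 2 < s))).map fun s => [bottomLeft s])
    (sortDown (L.filter fun s => decide (s ≤ 1 / 2)))

/-- The bins of a packing in non-increasing order of the number of items. -/
def sortByCount (P : List Bin) : List Bin :=
  P.mergeSort fun B B' => decide (B'.length ≤ B.length)

/-- The packing returned by the algorithm. -/
def algorithm (I : List ℝ) : List Bin :=
  packSmall I ++ sortByCount (FFDS (I.filter fun s => decide (1 / 3 < s)))

/-! ### An implementation with a step count

Programs are functional programs over linked lists, pairs, natural numbers and real numbers, in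
which every function call costs one step, and so does every comparison or arithmetic operation on
numbers (the real RAM convention). Between two steps a program only does a bounded number of
operations that inspect or build a single cell. -/

/-- A computation: its result and the number of steps it takes. -/
structure Timed (α : Type) where
  val : α
  steps : ℕ

instance : Monad Timed where
  pure a := ⟨a, 0⟩
  bind c f := ⟨(f c.val).val, c.steps + (f c.val).steps⟩

namespace Timed

/-- One step without a result: the cost of a function call. -/
def tick : Timed Unit := ⟨(), 1⟩

/-- A given number of steps without a result. -/
def charge (k : ℕ) : Timed Unit := ⟨(), k⟩

/-- The operations on real and natural numbers, one step each. -/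
def add (a b : ℝ) : Timed ℝ := ⟨a + b, 1⟩
def sub (a b : ℝ) : Timed ℝ := ⟨a - b, 1⟩
def mul (a b : ℝ) : Timed ℝ := ⟨a * b, 1⟩
def le (a b : ℝ) : Timed Bool := ⟨decide (a ≤ b), 1⟩
def lt (a b : ℝ) : Timed Bool := ⟨decide (a < b), 1⟩
def natLe (a b : ℕ) : Timed Bool := ⟨decide (a ≤ b), 1⟩
def natAdd (a b : ℕ) : Timed ℕ := ⟨a + b, 1⟩

def length {α : Type} : List α → Timed ℕ
  | [] => do
    tick
    return 0
  | _ :: xs => do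
    tick
    let k ← length xs
    natAdd k 1

def append {α : Type} : List α → List α → Timed (List α)
  | [], ys => do
    tick
    return ys
  | x :: xs, ys => do
    tick
    let zs ← append xs ys
    return x :: zs

def filter {α : Type} (p : α → Timed Bool) : List α → Timed (List α)
  | [] => do
    tick
    return []
  | x :: xs => do
    tick
    let b ← p x
    let ys ← filter p xs
    if b then return x :: ys else return ys

/-- Merging two sorted lists. -/
def merge {α : Type} (cmp : α → α → Timed Bool) : List α → List α → Timed (List α)
  | [], ys => do
    tick
    return ys
  | x :: xs, [] => do
    tick
    return x :: xs
  | x :: xs, y :: ys => do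
    tick
    let b ← cmp x y
    if b then
      let zs ← merge cmp xs (y :: ys)
      return x :: zs
    else
      let zs ← merge cmp (x :: xs) ys
      return y :: zs
termination_by xs ys => xs.length + ys.length
decreasing_by all_goals (simp only [List.length_cons]; omega)

/-- Merge sort of the first `k` entries of a list; the second component of the result is the rest
of the list. The two halves have `⌈k/2⌉` and `⌊k/2⌋` entries; computing these two numbers costs
three steps. -/
def sortFirst {α : Type} (cmp : α → α → Timed Bool) : ℕ → List α → Timed (List α × List α)
  | 0, xs => do
    tick
    return ([], xs)
  | 1, [] => do
    tick
    return ([], [])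
  | 1, x :: xs => do
    tick
    return ([x], xs)
  | k + 2, xs => do
    tick
    tick
    tick
    tick
    let a ← sortFirst cmp ((k + 3) / 2) xs
    let b ← sortFirst cmp ((k + 2) / 2) a.2
    let c ← merge cmp a.1 b.1
    return (c, b.2)
termination_by k => k
decreasing_by all_goals omega

def mergeSort {α : Type} (cmp : α → α → Timed Bool) (xs : List α) : Timed (List α) := do
  tick
  let k ← length xs
  let a ← sortFirst cmp k xs
  return a.1

def sortUp (L : List ℝ) : Timed (List ℝ) := do
  tick
  mergeSort (fun a b => le a b) L

def sortDown (L : List ℝ) : Timed (List ℝ) := do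
  tick
  mergeSort (fun a b => le b a) L

/-- Grouping, with the area `a` of the current group `G` kept in a variable. -/
def groupsFrom (G : List ℝ) (a : ℝ) : List ℝ → Timed (List (List ℝ))
  | [] => do
    tick
    match G with
    | [] => return []
    | s :: G' => return [s :: G']
  | s :: rest => do
    tick
    let q ← mul s s
    let a' ← add q a
    let b ← lt 1 a'
    if b then
      let gs ← groupsFrom [] 0 rest
      return (s :: G) :: gs
    else groupsFrom (s :: G) a' rest

def groups (I : List ℝ) : Timed (List (List ℝ)) := do
  tick
  let L ← sortUp I
  groupsFrom [] 0 L

def nextFitLevels (B : Bin) (y h w : ℝ) : List ℝ → Timed (List Bin)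
  | [] => do
    tick
    return [B]
  | s :: rest => do
    tick
    let w' ← add w s
    let b ← le w' 1
    if b then nextFitLevels (⟨s, w, y⟩ :: B) y h w' rest
    else
      let y' ← add y h
      let t ← add y' s
      let b' ← le t 1
      if b' then nextFitLevels (⟨s, 0, y'⟩ :: B) y' s s rest
      else
        let P ← nextFitLevels [⟨s, 0, 0⟩] 0 s s rest
        return B :: P

def nextFitStart : List ℝ → Timed (List Bin)
  | [] => do
    tick
    return []
  | s :: rest => do
    tick
    nextFitLevels [⟨s, 0, 0⟩] 0 s s rest

def NFDH (L : List ℝ) : Timed (List Bin) := do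
  tick
  let L' ← sortDown L
  nextFitStart L'

/-- Packing the small items of the given groups, group after group. -/
def packGroups : List (List ℝ) → Timed (List Bin)
  | [] => do
    tick
    return []
  | G :: gs => do
    tick
    let S ← filter (fun s => le s (1 / 3)) G
    let P ← NFDH S
    let Q ← packGroups gs
    append P Q

def packSmall (I : List ℝ) : Timed (List Bin) := do
  tick
  let gs ← groups I
  packGroups gs

/-- Placing an item in a given corner of a bin. -/
def bottomLeft (s : ℝ) : Timed PlacedSquare := do
  tick
  return ⟨s, 0, 0⟩

def bottomRight (s : ℝ) : Timed PlacedSquare := do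
  tick
  let t ← sub 1 s
  return ⟨s, t, 0⟩

def topLeft (s : ℝ) : Timed PlacedSquare := do
  tick
  let t ← sub 1 s
  return ⟨s, 0, t⟩

def topRight (s : ℝ) : Timed PlacedSquare := do
  tick
  let t ← sub 1 s
  return ⟨s, t, t⟩

/-- Placing items in the given corners, as long as there are corners and items. -/
def fillCorners : List (ℝ → Timed PlacedSquare) → List ℝ → Timed Bin
  | [], _ => do
    tick
    return []
  | _ :: _, [] => do
    tick
    return []
  | c :: cs, s :: L => do
    tick
    let p ← c s
    let B ← fillCorners cs L
    return p :: B

/-- Removing the first `k` entries of a list. -/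
def drop {α : Type} : ℕ → List α → Timed (List α)
  | 0, xs => do
    tick
    return xs
  | _ + 1, [] => do
    tick
    return []
  | k + 1, _ :: xs => do
    tick
    drop k xs

theorem drop_val {α : Type} (k : ℕ) (xs : List α) : (drop k xs).val = xs.drop k := by
  induction k generalizing xs with
  | zero => cases xs <;> rfl
  | succ k ih => cases xs with
    | nil => rfl
    | cons x xs => exact ih xs

/-- One bin for each of the given large items. -/
def singles : List ℝ → Timed (List Bin)
  | [] => do
    tick
    return []
  | s :: L => do
    tick
    let p ← bottomLeft s
    let P ← singles L
    return [p] :: P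

/-- The main loop of FFDS on the list `Ls` of the large items (in non-decreasing order) whose bins
hold no other item and the list of the remaining medium items (in non-increasing order). The
result consists of the bins of the items of `Ls` and the newly opened bins. As `Ls` is sorted, a
medium item that does not fit next to the first item of `Ls` fits next to none of them. (Charging the
steps of `drop k ms` and then using its value is the same as binding it; it is written in this way
only to make the termination of the recursion visible.) -/
def ffdsLoop (Ls : List ℝ) : List ℝ → Timed (List Bin × List Bin)
  | [] => do
    tick
    let P ← singles Ls
    return (P, [])
  | m :: ms => do
    tick
    match Ls with
    | [] =>
      let B ← fillCorners [bottomLeft, bottomRight, topLeft, topRight] (m :: ms)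
      charge (drop 3 ms).steps
      let P ← ffdsLoop [] (drop 3 ms).val
      return (P.1, B :: P.2)
    | l :: Ls' =>
      let t ← add l m
      let b ← le t 1
      if b then
        let p ← bottomLeft l
        let B ← fillCorners [bottomRight, topLeft, topRight] (m :: ms)
        charge (drop 2 ms).steps
        let P ← ffdsLoop Ls' (drop 2 ms).val
        return ((p :: B) :: P.1, P.2)
      else
        let B ← fillCorners [bottomLeft, bottomRight, topLeft, topRight] (m :: ms)
        charge (drop 3 ms).steps
        let P ← ffdsLoop (l :: Ls') (drop 3 ms).val
        return (P.1, B :: P.2)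
termination_by L => L.length
decreasing_by all_goals (simp only [drop_val, List.length_drop, List.length_cons]; omega)

def FFDS (L : List ℝ) : Timed (List Bin) := do
  tick
  let A ← filter (fun s => lt (1 / 2) s) L
  let Ls ← sortUp A
  let M ← filter (fun s => le s (1 / 2)) L
  let Ms ← sortDown M
  let P ← ffdsLoop Ls Ms
  append P.1 P.2

/-- Comparing two bins by their numbers of items. -/
def countCmp (B B' : Bin) : Timed Bool := do
  tick
  let k ← length B
  let k' ← length B'
  natLe k' k

def sortByCount (P : List Bin) : Timed (List Bin) := do
  tick
  mergeSort countCmp P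

/-- The implementation of the algorithm. -/
def algorithm (I : List ℝ) : Timed (List Bin) := do
  tick
  let P ← packSmall I
  let L ← filter (fun s => lt (1 / 3) s) I
  let Q ← FFDS L
  let Q' ← sortByCount Q
  append P Q'

end Timed

end

end SquareMinSum

/-!
The approximation ratio rests on two lower bounds for the cost of an arbitrary packing. Call the
items of size at most `1/3` small and the others big; a big item is large if its size exceeds `1/2`
and medium otherwise.

* *Area.* A bin has area `1`, whereas every group but the last one has area more than `1`. Hence the
  first `j` bins of a packing hold at most as many items as the first `j` groups, and the packing
  costs at least as much as placing the `j`-th group in the `j`-th bin (`countCost_groups_le`). This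
  holds for the groups of all items, where it yields `S + D` with the contributions `S` of the small
  and `D` of the big items, and for the small items alone, where it yields `S`.
* *Corners.* For all `j`, the first `j` bins of FFDS hold at least as many items as any `j` bins of
  another packing of the big items (`cost_FFDS_le`): a bin holds at most four big items, two items
  of a bin have total size at most `1`, and the large items that FFDS leaves alone do not fit with
  the medium items for which it has opened new bins. So FFDS, with cost `F`, is optimal on the big
  items, and a packing costs at least `S + F`.

On the other hand, NFDH needs at most two bins for the small items of a group
(`length_nextFitStart_le_two`). So the small items cost at most `2 * S`, and with `r` groups of
small items only, the `L` big items are preceded by at most `2 * (r + 1)` bins, which makes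
`2 * S + 2 * (r + 1) * L + F` in total. As a group of small items only has at least ten items and a
group has at most nine big items, `S ≥ 5 * r * (r + 1)` and `D ≥ r * L + L * (L + 1) / 18`. The
bounds `S + D` and `S + F`, weighted with `31/22` and `1`, then suffice (`ratio_inequality`).

The implementation returns the same packing since the large items whose bins are open form a sorted
list, so that first fit only has to look at the first one of them (`ffdsLoop_eq`). Its running time
is dominated by the merge sorts.
-/

namespace SquareMinSum

/-! ### Running time and results of the list programs -/

namespace Timed

variable {α β : Type}

@[simp] theorem bind_val (c : Timed α) (f : α → Timed β) : (c >>= f).val = (f c.val).val := rfl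

@[simp] theorem bind_steps (c : Timed α) (f : α → Timed β) :
    (c >>= f).steps = c.steps + (f c.val).steps := rfl

@[simp] theorem pure_val (a : α) : (pure a : Timed α).val = a := rfl

@[simp] theorem pure_steps (a : α) : (pure a : Timed α).steps = 0 := rfl

@[simp] theorem tick_steps : tick.steps = 1 := rfl

@[simp] theorem charge_steps (k : ℕ) : (charge k).steps = k := rfl

@[simp] theorem add_val (a b : ℝ) : (add a b).val = a + b := rfl
@[simp] theorem mul_val (a b : ℝ) : (mul a b).val = a * b := rfl
@[simp] theorem le_val (a b : ℝ) : (le a b).val = decide (a ≤ b) := rfl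
@[simp] theorem lt_val (a b : ℝ) : (lt a b).val = decide (a < b) := rfl
@[simp] theorem natLe_val (a b : ℕ) : (natLe a b).val = decide (a ≤ b) := rfl
@[simp] theorem natAdd_val (a b : ℕ) : (natAdd a b).val = a + b := rfl
@[simp] theorem add_steps (a b : ℝ) : (add a b).steps = 1 := rfl
@[simp] theorem sub_steps (a b : ℝ) : (sub a b).steps = 1 := rfl
@[simp] theorem mul_steps (a b : ℝ) : (mul a b).steps = 1 := rfl
@[simp] theorem le_steps (a b : ℝ) : (le a b).steps = 1 := rfl
@[simp] theorem lt_steps (a b : ℝ) : (lt a b).steps = 1 := rfl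
@[simp] theorem natLe_steps (a b : ℕ) : (natLe a b).steps = 1 := rfl
@[simp] theorem natAdd_steps (a b : ℕ) : (natAdd a b).steps = 1 := rfl

@[simp] theorem length_val (xs : List α) : (length xs).val = xs.length := by
  induction xs with
  | nil => rfl
  | cons x xs ih => simp [length, ih]

@[simp] theorem length_steps (xs : List α) : (length xs).steps = 2 * xs.length + 1 := by
  induction xs with
  | nil => rfl
  | cons x xs ih => simp [length, ih]; ring

@[simp] theorem append_val (xs ys : List α) : (append xs ys).val = xs ++ ys := by
  induction xs with
  | nil => rfl
  | cons x xs ih => simp [append, ih]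

@[simp] theorem append_steps (xs ys : List α) : (append xs ys).steps = xs.length + 1 := by
  induction xs with
  | nil => rfl
  | cons x xs ih => simp [append, ih]; ring

@[simp] theorem filter_val (p : α → Timed Bool) (xs : List α) :
    (filter p xs).val = xs.filter fun x => (p x).val := by
  induction xs with
  | nil => rfl
  | cons x xs ih => cases h : (p x).val <;> simp [filter, ih, h]

theorem filter_steps (p : α → Timed Bool) (hp : ∀ x, (p x).steps = 1) (xs : List α) :
    (filter p xs).steps = 2 * xs.length + 1 := by
  induction xs with
  | nil => rfl
  | cons x xs ih => cases h : (p x).val <;> simp [filter, ih, h, hp] <;> ring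

@[simp] theorem merge_val (cmp : α → α → Timed Bool) (xs ys : List α) :
    (merge cmp xs ys).val = List.merge xs ys fun a b => (cmp a b).val := by
  induction xs generalizing ys with
  | nil => simp [merge]
  | cons x xs ih =>
    induction ys with
    | nil => simp [merge]
    | cons y ys ih' =>
      cases h : (cmp x y).val <;> simp [merge, ih, ih', h]

theorem merge_steps (cmp : α → α → Timed Bool) (K : ℕ) (xs ys : List α)
    (h : ∀ x ∈ xs, ∀ y ∈ ys, (cmp x y).steps ≤ K) :
    (merge cmp xs ys).steps ≤ (K + 1) * (xs.length + ys.length) + 1 := by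
  induction xs generalizing ys with
  | nil => simp [merge]
  | cons x xs ih =>
    induction ys with
    | nil => simp [merge]
    | cons y ys ih' =>
      have h0 := h x (by simp) y (by simp)
      have h1 := ih (y :: ys) fun a ha b hb => h a (by simp [ha]) b hb
      have h2 := ih' fun a ha b hb => h a ha b (by simp [hb])
      simp only [List.length_cons] at h1 h2 ⊢
      cases hc : (cmp x y).val <;> simp [merge, hc] <;> nlinarith

theorem sortFirst_val (cmp : α → α → Timed Bool) (k : ℕ) (xs : List α) (h : k ≤ xs.length) :
    (sortFirst cmp k xs).val =
      ((xs.take k).mergeSort fun a b => (cmp a b).val, xs.drop k) := by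
  induction k using Nat.strong_induction_on generalizing xs with
  | _ k ih =>
    match k, xs, h with
    | 0, xs, _ => simp [sortFirst]
    | 1, x :: xs, _ => simp [sortFirst]
    | k + 2, a :: b :: xs, h =>
      simp only [List.length_cons] at h
      have h1 := ih ((k + 3) / 2) (by omega) (a :: b :: xs) (by simp; omega)
      have h2 := ih ((k + 2) / 2) (by omega) ((a :: b :: xs).drop ((k + 3) / 2))
        (by simp; omega)
      have e1 : (k + 3) / 2 + (k + 2) / 2 = k + 2 := by omega
      have e2 : (xs.take k).length = k := by simp; omega
      rw [sortFirst]
      simp only [bind_val, h1, h2, pure_val, merge_val, List.drop_drop, e1, List.take_succ_cons]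
      rw [List.mergeSort]
      simp only [List.MergeSort.Internal.splitInTwo_fst, List.MergeSort.Internal.splitInTwo_snd,
        List.length_cons, e2]
      have e3 : (k + 1 + 1 + 1) / 2 = (k + 3) / 2 := by omega
      have e4 : a :: b :: xs.take k = (a :: b :: xs).take (k + 2) := by simp
      rw [e3, e4, List.take_take, List.drop_take, Nat.min_eq_left (by omega)]
      have e5 : k + 2 - (k + 3) / 2 = (k + 2) / 2 := by omega
      rw [e5]

@[simp] theorem mergeSort_val (cmp : α → α → Timed Bool) (xs : List α) :
    (mergeSort cmp xs).val = xs.mergeSort fun a b => (cmp a b).val := by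
  simp [mergeSort, sortFirst_val]

/-- The recursion for the running time is governed by `⌈log₂ k⌉`, which drops by one for both of
the halves `⌈k/2⌉` and `⌊k/2⌋`. -/
theorem sortFirst_steps (cmp : α → α → Timed Bool) (K k : ℕ) (xs : List α) (h : k ≤ xs.length)
    (hk : 1 ≤ k) (hc : ∀ x ∈ xs, ∀ y ∈ xs, (cmp x y).steps ≤ K) :
    (sortFirst cmp k xs).steps + 5 ≤ (K + 1) * (k * Nat.clog 2 k) + 6 * k := by
  induction k using Nat.strong_induction_on generalizing xs with
  | _ k ih =>
    match k, xs, h with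
    | 1, x :: xs, _ => simp [sortFirst]
    | k + 2, xs, h =>
      have h1 := ih ((k + 3) / 2) (by omega) xs (by omega) (by omega) hc
      have h2 := ih ((k + 2) / 2) (by omega) (xs.drop ((k + 3) / 2)) (by simp; omega)
        (by omega) fun x hx y hy => hc x (List.mem_of_mem_drop hx) y (List.mem_of_mem_drop hy)
      have e1 : (k + 3) / 2 + (k + 2) / 2 = k + 2 := by omega
      have c1 : Nat.clog 2 (k + 2) = Nat.clog 2 ((k + 3) / 2) + 1 := by
        rw [Nat.clog_of_two_le (by norm_num) (by omega)]
        rfl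
      have c2 : Nat.clog 2 ((k + 2) / 2) ≤ Nat.clog 2 ((k + 3) / 2) :=
        Nat.clog_mono_right _ (by omega)
      rw [sortFirst]
      simp only [bind_steps, tick_steps, pure_steps]
      rw [sortFirst_val cmp _ xs (by omega)]
      simp only []
      rw [sortFirst_val cmp _ (xs.drop ((k + 3) / 2)) (by simp; omega)]
      simp only []
      have h3 := merge_steps cmp K ((xs.take ((k + 3) / 2)).mergeSort fun a b => (cmp a b).val)
        (((xs.drop ((k + 3) / 2)).take ((k + 2) / 2)).mergeSort fun a b => (cmp a b).val)
        (fun x hx y hy => hc x (List.mem_of_mem_take (List.mem_mergeSort.1 hx)) y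
          (List.mem_of_mem_drop (List.mem_of_mem_take (List.mem_mergeSort.1 hy))))
      have e3 : ((xs.take ((k + 3) / 2)).mergeSort fun a b => (cmp a b).val).length
          + (((xs.drop ((k + 3) / 2)).take ((k + 2) / 2)).mergeSort
            fun a b => (cmp a b).val).length = k + 2 := by
        simp; omega
      rw [e3] at h3
      have h4 : (k + 2) / 2 * Nat.clog 2 ((k + 2) / 2)
          ≤ (k + 2) / 2 * Nat.clog 2 ((k + 3) / 2) := Nat.mul_le_mul_left _ c2
      have h5 : (k + 2) * Nat.clog 2 (k + 2) = (k + 3) / 2 * Nat.clog 2 ((k + 3) / 2)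
          + (k + 2) / 2 * Nat.clog 2 ((k + 3) / 2) + (k + 2) := by
        rw [c1, ← add_mul, e1]; ring
      have h6 := Nat.mul_le_mul_left (K + 1) h4
      rw [h5]
      generalize (k + 3) / 2 = u at *
      generalize (k + 2) / 2 = v at *
      linarith

theorem mergeSort_steps (cmp : α → α → Timed Bool) (K : ℕ) (xs : List α)
    (hc : ∀ x ∈ xs, ∀ y ∈ xs, (cmp x y).steps ≤ K) :
    (mergeSort cmp xs).steps ≤
      (K + 1) * (xs.length * Nat.clog 2 xs.length) + 8 * xs.length + 3 := by
  rcases Nat.eq_zero_or_pos xs.length with h0 | h0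
  · obtain rfl := List.length_eq_zero_iff.1 h0
    simp [mergeSort, sortFirst]
  · have := sortFirst_steps cmp K xs.length xs le_rfl h0 hc
    simp only [mergeSort, bind_steps, tick_steps, length_steps, length_val, pure_steps]
    linarith

@[simp] theorem sortUp_val (L : List ℝ) : (sortUp L).val = SquareMinSum.sortUp L := by
  simp [sortUp, SquareMinSum.sortUp]

@[simp] theorem sortDown_val (L : List ℝ) : (sortDown L).val = SquareMinSum.sortDown L := by
  simp [sortDown, SquareMinSum.sortDown]

theorem sortUp_steps (L : List ℝ) :
    (sortUp L).steps ≤ 2 * (L.length * Nat.clog 2 L.length) + 8 * L.length + 4 := by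
  have := mergeSort_steps (fun a b => le a b) 1 L (by simp)
  simp only [sortUp, bind_steps, tick_steps]
  linarith

theorem sortDown_steps (L : List ℝ) :
    (sortDown L).steps ≤ 2 * (L.length * Nat.clog 2 L.length) + 8 * L.length + 4 := by
  have := mergeSort_steps (fun a b => le b a) 1 L (by simp)
  simp only [sortDown, bind_steps, tick_steps]
  linarith

theorem groupsFrom_val (G L : List ℝ) :
    (groupsFrom G (area G) L).val = SquareMinSum.groupsFrom G L := by
  induction L generalizing G with
  | nil => cases G <;> rfl
  | cons s rest ih =>
    have ha : s * s + area G = area (s :: G) := by simp [area, pow_two]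
    have h0 : area [] = 0 := by simp [area]
    have ih0 := ih []
    rw [h0] at ih0
    rw [SquareMinSum.groupsFrom]
    by_cases h : 1 < area (s :: G) <;> simp [groupsFrom, ha, h, ih0, ih]

theorem groupsFrom_steps (G : List ℝ) (a : ℝ) (L : List ℝ) :
    (groupsFrom G a L).steps = 4 * L.length + 1 := by
  induction L generalizing G a with
  | nil => cases G <;> rfl
  | cons s rest ih =>
    by_cases h : 1 < s * s + a <;> simp [groupsFrom, h, ih] <;> ring

@[simp] theorem groups_val (I : List ℝ) : (groups I).val = SquareMinSum.groups I := by
  have := groupsFrom_val [] (SquareMinSum.sortUp I)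
  rw [show area [] = 0 by simp [area]] at this
  simp [groups, SquareMinSum.groups, this]

theorem nextFitLevels_val (B : Bin) (y h w : ℝ) (L : List ℝ) :
    (nextFitLevels B y h w L).val = SquareMinSum.nextFitLevels B y h w L := by
  induction L generalizing B y h w with
  | nil => rfl
  | cons s rest ih =>
    rw [SquareMinSum.nextFitLevels]
    by_cases h1 : w + s ≤ 1
    · simp [nextFitLevels, h1, ih]
    · by_cases h2 : y + h + s ≤ 1 <;> simp [nextFitLevels, h1, h2, ih]

theorem nextFitLevels_steps (B : Bin) (y h w : ℝ) (L : List ℝ) :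
    (nextFitLevels B y h w L).steps ≤ 6 * L.length + 1 := by
  induction L generalizing B y h w with
  | nil => simp [nextFitLevels]
  | cons s rest ih =>
    by_cases h1 : w + s ≤ 1
    · have := ih (⟨s, w, y⟩ :: B) y h (w + s)
      simp [nextFitLevels, h1]; omega
    · by_cases h2 : y + h + s ≤ 1
      · have := ih (⟨s, 0, y + h⟩ :: B) (y + h) s s
        simp [nextFitLevels, h1, h2]; omega
      · have := ih [⟨s, 0, 0⟩] 0 s s
        simp [nextFitLevels, h1, h2]; omega

@[simp] theorem NFDH_val (L : List ℝ) : (NFDH L).val = SquareMinSum.NFDH L := by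
  simp only [NFDH, SquareMinSum.NFDH, bind_val, sortDown_val]
  cases SquareMinSum.sortDown L with
  | nil => rfl
  | cons s rest => simp [nextFitStart, SquareMinSum.nextFitStart, nextFitLevels_val]

theorem length_sortUp (L : List ℝ) : (SquareMinSum.sortUp L).length = L.length := by
  simp [SquareMinSum.sortUp]

theorem length_sortDown (L : List ℝ) : (SquareMinSum.sortDown L).length = L.length := by
  simp [SquareMinSum.sortDown]

theorem NFDH_steps (L : List ℝ) :
    (NFDH L).steps ≤ 2 * (L.length * Nat.clog 2 L.length) + 14 * L.length + 7 := by
  have h1 := sortDown_steps L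
  have h2 : (nextFitStart (SquareMinSum.sortDown L)).steps ≤ 6 * L.length + 2 := by
    have h3 := length_sortDown L
    cases h : SquareMinSum.sortDown L with
    | nil => simp [nextFitStart]
    | cons s rest =>
      rw [h] at h3
      have := nextFitLevels_steps [⟨s, 0, 0⟩] 0 s s rest
      simp only [nextFitStart, bind_steps, tick_steps]
      simp at h3
      omega
  simp only [NFDH, bind_steps, tick_steps, sortDown_val]
  linarith

@[simp] theorem packGroups_val (gs : List (List ℝ)) : (packGroups gs).val =
    gs.flatMap fun G => SquareMinSum.NFDH (G.filter fun s => decide (s ≤ 1 / 3)) := by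
  induction gs with
  | nil => rfl
  | cons G gs ih => simp [packGroups, ih]

@[simp] theorem packSmall_val (I : List ℝ) : (packSmall I).val = SquareMinSum.packSmall I := by
  simp [packSmall, SquareMinSum.packSmall]

end Timed

theorem length_nextFitLevels_le (B : Bin) (y h w : ℝ) (L : List ℝ) :
    (nextFitLevels B y h w L).length ≤ L.length + 1 := by
  induction L generalizing B y h w with
  | nil => simp [nextFitLevels]
  | cons s rest ih =>
    rw [nextFitLevels]
    split_ifs
    · have := ih (⟨s, w, y⟩ :: B) y h (w + s); simp; omega
    · have := ih (⟨s, 0, y + h⟩ :: B) (y + h) s s; simp; omega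
    · have := ih [⟨s, 0, 0⟩] 0 s s; simp; omega

theorem length_NFDH_le (L : List ℝ) : (NFDH L).length ≤ L.length := by
  have h := Timed.length_sortDown L
  unfold NFDH
  cases h' : sortDown L with
  | nil => simp [nextFitStart]
  | cons s rest =>
    rw [h'] at h
    have := length_nextFitLevels_le [⟨s, 0, 0⟩] 0 s s rest
    simp only [nextFitStart]
    simp at h
    omega

theorem groupsFrom_ne_nil (G L : List ℝ) : [] ∉ groupsFrom G L := by
  induction L generalizing G with
  | nil => cases G <;> simp [groupsFrom]
  | cons s rest ih => rw [groupsFrom]; split_ifs <;> simp [ih]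

theorem flatten_groupsFrom_perm (G L : List ℝ) : (groupsFrom G L).flatten.Perm (G ++ L) := by
  induction L generalizing G with
  | nil => cases G <;> simp [groupsFrom]
  | cons s rest ih =>
    rw [groupsFrom]
    split_ifs
    · have := ih []
      simp only [List.flatten_cons, List.cons_append, List.nil_append] at this ⊢
      exact ((List.Perm.append_left G this).cons s).trans List.perm_middle.symm
    · exact (ih _).trans List.perm_middle.symm

theorem sortUp_perm (L : List ℝ) : (sortUp L).Perm L := List.mergeSort_perm _ _

theorem sortDown_perm (L : List ℝ) : (sortDown L).Perm L := List.mergeSort_perm _ _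

theorem flatten_groups_perm (I : List ℝ) : (groups I).flatten.Perm I := by
  exact (flatten_groupsFrom_perm [] (sortUp I)).trans (sortUp_perm I)

theorem length_le_length_flatten {α : Type*} {gs : List (List α)} (h : [] ∉ gs) :
    gs.length ≤ gs.flatten.length := by
  induction gs with
  | nil => simp
  | cons G gs ih =>
    simp only [List.mem_cons, not_or] at h
    have := ih h.2
    have := List.length_pos_iff.2 (Ne.symm h.1)
    simp only [List.length_cons, List.flatten_cons, List.length_append]
    omega

namespace Timed

theorem packGroups_steps (n : ℕ) (gs : List (List ℝ)) (h : gs.flatten.length ≤ n) :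
    (packGroups gs).steps ≤
      2 * (gs.flatten.length * Nat.clog 2 n) + 17 * gs.flatten.length + 10 * gs.length + 1 := by
  induction gs with
  | nil => simp [packGroups]
  | cons G gs ih =>
    simp only [List.flatten_cons, List.length_append] at h
    have h1 := ih (by omega)
    have hf : (G.filter fun s => decide (s ≤ 1 / 3)).length ≤ G.length := List.length_filter_le _ _
    have h2 := NFDH_steps (G.filter fun s => decide (s ≤ 1 / 3))
    have h3 := length_NFDH_le (G.filter fun s => decide (s ≤ 1 / 3))
    have h4 := filter_steps (fun s => le s (1 / 3)) (fun _ => rfl) G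
    have h5 : (G.filter fun s => decide (s ≤ 1 / 3)).length
        * Nat.clog 2 (G.filter fun s => decide (s ≤ 1 / 3)).length ≤ G.length * Nat.clog 2 n :=
      Nat.mul_le_mul hf (Nat.clog_mono_right _ (by omega))
    simp only [packGroups, bind_steps, tick_steps, filter_val, le_val, NFDH_val, append_steps,
      List.length_cons, List.flatten_cons, List.length_append, add_mul]
    generalize (G.filter fun s => decide (s ≤ 1 / 3)).length = u at *
    linarith

theorem packSmall_steps (I : List ℝ) :
    (packSmall I).steps ≤ 4 * (I.length * Nat.clog 2 I.length) + 39 * I.length + 8 := by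
  have h1 := sortUp_steps I
  have h2 := groupsFrom_steps [] 0 (SquareMinSum.sortUp I)
  have h3 := (flatten_groups_perm I).length_eq
  have h4 := packGroups_steps I.length (SquareMinSum.groups I) h3.le
  have h5 := length_le_length_flatten (groupsFrom_ne_nil [] (SquareMinSum.sortUp I))
  change (SquareMinSum.groups I).length ≤ (SquareMinSum.groups I).flatten.length at h5
  rw [h3] at h4 h5
  rw [length_sortUp] at h2
  have h6 : (groups I).steps = 1 + ((sortUp I).steps + (4 * I.length + 1)) := by
    simp only [groups, bind_steps, tick_steps, sortUp_val, h2]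
  simp only [packSmall, bind_steps, tick_steps, groups_val, h6]
  linarith

end Timed

/-! ### First Fit Decreasing Size: the implementation and its recursion -/

/-- The pairs of lists visited by the main loop of FFDS: `Ls` holds the sizes of the large items
that are alone in their bins, the second list the medium items that remain. -/
theorem ffds_induction {motive : List ℝ → List ℝ → Prop} (nil : ∀ Ls, motive Ls [])
    (none : ∀ m ms, motive [] (ms.drop 3) → motive [] (m :: ms))
    (pair : ∀ l Ls m ms, l + m ≤ 1 → motive Ls (ms.drop 2) → motive (l :: Ls) (m :: ms))
    (skip : ∀ l Ls m ms, ¬ l + m ≤ 1 → motive (l :: Ls) (ms.drop 3) →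
      motive (l :: Ls) (m :: ms)) (Ls ms : List ℝ) : motive Ls ms := by
  induction hn : ms.length using Nat.strong_induction_on generalizing Ls ms with
  | _ n ih =>
    match Ls, ms with
    | Ls, [] => exact nil Ls
    | [], m :: ms => exact none m ms (ih _ (by simp at hn ⊢; omega) _ _ rfl)
    | l :: Ls, m :: ms =>
      by_cases h : l + m ≤ 1
      · exact pair l Ls m ms h (ih _ (by simp at hn ⊢; omega) _ _ rfl)
      · exact skip l Ls m ms h (ih _ (by simp at hn ⊢; omega) _ _ rfl)

namespace Timed

@[simp] theorem bottomLeft_val (s : ℝ) : (bottomLeft s).val = SquareMinSum.bottomLeft s := rfl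

theorem fillCorners_val (cs : List (ℝ → Timed PlacedSquare)) (L : List ℝ) :
    (fillCorners cs L).val = List.zipWith (fun c s => (c s).val) cs L := by
  induction cs generalizing L with
  | nil => rfl
  | cons c cs ih =>
    cases L with
    | nil => rfl
    | cons s L => simp [fillCorners, ih]

@[simp] theorem fillCorners_four (L : List ℝ) :
    (fillCorners [bottomLeft, bottomRight, topLeft, topRight] L).val = fourCorners L := by
  rw [fillCorners_val]
  rcases L with _ | ⟨a, _ | ⟨b, _ | ⟨c, _ | ⟨d, L⟩⟩⟩⟩ <;> rfl

@[simp] theorem fillCorners_three (L : List ℝ) :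
    (fillCorners [bottomRight, topLeft, topRight] L).val = threeCorners L := by
  rw [fillCorners_val]
  rcases L with _ | ⟨a, _ | ⟨b, _ | ⟨c, L⟩⟩⟩ <;> rfl

theorem fillCorners_steps (cs : List (ℝ → Timed PlacedSquare)) (L : List ℝ)
    (h : ∀ c ∈ cs, ∀ s, (c s).steps ≤ 2) : (fillCorners cs L).steps ≤ 3 * cs.length + 1 := by
  induction cs generalizing L with
  | nil => simp [fillCorners]
  | cons c cs ih =>
    cases L with
    | nil => simp [fillCorners]
    | cons s L =>
      have h1 := h c (by simp) s
      have h2 := ih L fun c hc => h c (by simp [hc])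
      simp [fillCorners]; omega

theorem drop_steps {α : Type} (k : ℕ) (xs : List α) : (drop k xs).steps ≤ k + 1 := by
  induction k generalizing xs with
  | zero => cases xs <;> simp [drop]
  | succ k ih =>
    cases xs with
    | nil => simp [drop]
    | cons x xs => have := ih xs; simp [drop]; omega

@[simp] theorem singles_val (L : List ℝ) :
    (singles L).val = L.map fun s => [SquareMinSum.bottomLeft s] := by
  induction L with
  | nil => rfl
  | cons s L ih => simp [singles, ih]

theorem singles_steps (L : List ℝ) : (singles L).steps = 2 * L.length + 1 := by
  induction L with
  | nil => rfl
  | cons s L ih => simp [singles, bottomLeft, ih]; ring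

theorem ffdsLoop_nil (Ls : List ℝ) :
    (ffdsLoop Ls []).val = (Ls.map fun s => [SquareMinSum.bottomLeft s], []) := by
  simp [ffdsLoop]

theorem ffdsLoop_none (m : ℝ) (ms : List ℝ) : (ffdsLoop [] (m :: ms)).val =
    ((ffdsLoop [] (ms.drop 3)).val.1,
      fourCorners (m :: ms) :: (ffdsLoop [] (ms.drop 3)).val.2) := by
  rw [ffdsLoop]
  simp [drop_val]

theorem ffdsLoop_pair {l m : ℝ} (h : l + m ≤ 1) (Ls ms : List ℝ) :
    (ffdsLoop (l :: Ls) (m :: ms)).val =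
      ((SquareMinSum.bottomLeft l :: threeCorners (m :: ms)) :: (ffdsLoop Ls (ms.drop 2)).val.1,
        (ffdsLoop Ls (ms.drop 2)).val.2) := by
  rw [ffdsLoop]
  simp [drop_val, h]

theorem ffdsLoop_skip {l m : ℝ} (h : ¬ l + m ≤ 1) (Ls ms : List ℝ) :
    (ffdsLoop (l :: Ls) (m :: ms)).val =
      ((ffdsLoop (l :: Ls) (ms.drop 3)).val.1,
        fourCorners (m :: ms) :: (ffdsLoop (l :: Ls) (ms.drop 3)).val.2) := by
  rw [ffdsLoop]
  simp [drop_val, h]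

theorem ffdsLoop_steps (Ls ms : List ℝ) :
    (ffdsLoop Ls ms).steps ≤ 2 * Ls.length + 21 * ms.length + 2 := by
  have h4 : ∀ L, (fillCorners [bottomLeft, bottomRight, topLeft, topRight] L).steps ≤ 13 :=
    fun L => fillCorners_steps _ L (by
      simp [bottomLeft, bottomRight, topLeft, topRight])
  have h3 : ∀ L, (fillCorners [bottomRight, topLeft, topRight] L).steps ≤ 10 :=
    fun L => fillCorners_steps _ L (by simp [bottomRight, topLeft, topRight])
  induction Ls, ms using ffds_induction with
  | nil Ls => simp [ffdsLoop, singles_steps]; omega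
  | none m ms ih =>
    have := h4 (m :: ms)
    have := drop_steps 3 ms
    rw [ffdsLoop]
    simp [drop_val] at ih ⊢
    omega
  | pair l Ls m ms h ih =>
    have := h3 (m :: ms)
    have := drop_steps 2 ms
    rw [ffdsLoop]
    simp [drop_val, h, bottomLeft] at ih ⊢
    omega
  | skip l Ls m ms h ih =>
    have := h4 (m :: ms)
    have := drop_steps 3 ms
    rw [ffdsLoop]
    simp [drop_val, h] at ih ⊢
    omega

theorem length_ffdsLoop (Ls ms : List ℝ) :
    (ffdsLoop Ls ms).val.1.length = Ls.length ∧
      (ffdsLoop Ls ms).val.2.length ≤ ms.length := by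
  induction Ls, ms using ffds_induction with
  | nil Ls => simp [ffdsLoop_nil]
  | none m ms ih =>
    simp only [ffdsLoop_none, List.length_drop, List.length_cons] at ih ⊢; omega
  | pair l Ls m ms h ih =>
    simp only [ffdsLoop_pair h, List.length_drop, List.length_cons] at ih ⊢; omega
  | skip l Ls m ms h ih =>
    simp only [ffdsLoop_skip h, List.length_drop, List.length_cons] at ih ⊢; omega

end Timed

@[simp] theorem length_fourCorners (L : List ℝ) : (fourCorners L).length = min 4 L.length := by
  simp [fourCorners]

@[simp] theorem length_threeCorners (L : List ℝ) : (threeCorners L).length = min 3 L.length := by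
  simp [threeCorners]

theorem fitsIn_eq_false {m : ℝ} {B : Bin} (h : 2 ≤ B.length) : fitsIn m B = false := by
  simp only [fitsIn, decide_eq_false_iff_not]
  rintro ⟨p, rfl, -⟩
  simp at h

@[simp] theorem fitsIn_single (m l : ℝ) : fitsIn m [bottomLeft l] = decide (l + m ≤ 1) := by
  simp [fitsIn, bottomLeft]

theorem findIdx_fitsIn_eq_none {m : ℝ} {D : List Bin} (h : ∀ B ∈ D, 2 ≤ B.length) :
    D.findIdx? (fitsIn m) = none :=
  List.findIdx?_eq_none_iff.2 fun B hB => fitsIn_eq_false (h B hB)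

theorem modify_append_cons {α : Type*} (D R : List α) (x : α) (f : α → α) :
    (D ++ x :: R).modify D.length f = D ++ f x :: R := by
  induction D with
  | nil => simp
  | cons d D ih => simp [ih]

/-- A newly opened bin with fewer than two items exhausts the list. -/
theorem two_le_length_of_open {D N : List Bin} (m : ℝ) (ms : List ℝ)
    (h : ∀ B ∈ D ++ N, 2 ≤ B.length) :
    ms.drop 3 = [] ∨ ∀ B ∈ D ++ (N ++ [fourCorners (m :: ms)]), 2 ≤ B.length := by
  rcases ms with _ | ⟨a, ms⟩
  · simp
  · right
    intro B hB
    rw [← List.append_assoc, List.mem_append] at hB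
    rcases hB with hB | hB
    · exact h B hB
    · obtain rfl := List.mem_singleton.1 hB
      simp

/-- Throughout FFDS the open bins are the completed bins `D` of the smallest large items, the bins
of the other large items `Ls`, and the newly opened bins `N`, where the bins of `D` and `N` have at
least two items as long as items remain. As `Ls` is sorted, the first bin of `Ls` is the only
candidate for first fit. -/
theorem ffdsLoop_eq (Ls ms : List ℝ) (D N : List Bin) (hLs : Ls.Pairwise (· ≤ ·))
    (hDN : ms = [] ∨ ∀ B ∈ D ++ N, 2 ≤ B.length) :
    ffdsLoop (D ++ (Ls.map (fun s => [bottomLeft s]) ++ N)) ms =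
      D ++ ((Timed.ffdsLoop Ls ms).val.1 ++ (N ++ (Timed.ffdsLoop Ls ms).val.2)) := by
  induction Ls, ms using ffds_induction generalizing D N with
  | nil Ls => simp [ffdsLoop, Timed.ffdsLoop_nil]
  | none m ms ih =>
    have hDN := hDN.resolve_left (by simp)
    have hf : (D ++ ([] ++ N)).findIdx? (fitsIn m) = none :=
      findIdx_fitsIn_eq_none (by simpa using hDN)
    have h2 := ih D (N ++ [fourCorners (m :: ms)]) .nil (two_le_length_of_open m ms hDN)
    rw [ffdsLoop]
    simp only [List.map_nil] at h2 ⊢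
    rw [hf, Timed.ffdsLoop_none]
    simpa using h2
  | pair l Ls m ms h ih =>
    have hDN := hDN.resolve_left (by simp)
    have hD : D.findIdx? (fitsIn m) = none :=
      findIdx_fitsIn_eq_none fun B hB => hDN B (by simp [hB])
    have hf : (D ++ ((l :: Ls).map (fun s => [bottomLeft s]) ++ N)).findIdx? (fitsIn m)
        = some D.length := by
      rw [List.findIdx?_append, hD]
      simp [List.findIdx?_cons, h]
    have h2 := ih (D ++ [bottomLeft l :: threeCorners (m :: ms)]) N hLs.of_cons (by
      right
      intro B hB
      simp only [List.mem_append, List.mem_singleton] at hB hDN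
      rcases hB with (hB | hB) | hB
      · exact hDN B (Or.inl hB)
      · subst hB; simp
      · exact hDN B (Or.inr hB))
    rw [ffdsLoop, hf, Timed.ffdsLoop_pair h]
    simp only [List.map_cons, List.cons_append, modify_append_cons]
    simpa using h2
  | skip l Ls m ms h ih =>
    have hDN := hDN.resolve_left (by simp)
    have hf : (D ++ ((l :: Ls).map (fun s => [bottomLeft s]) ++ N)).findIdx? (fitsIn m)
        = none := by
      rw [List.findIdx?_eq_none_iff]
      intro B hB
      simp only [List.mem_append, List.mem_map] at hB hDN
      rcases hB with hB | ⟨s, hs, rfl⟩ | hB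
      · exact fitsIn_eq_false (hDN B (Or.inl hB))
      · have : l ≤ s := by
          rcases List.mem_cons.1 hs with rfl | hs
          · exact le_rfl
          · exact List.rel_of_pairwise_cons hLs hs
        rw [fitsIn_single, decide_eq_false_iff_not]
        intro h'
        exact h (by linarith)
      · exact fitsIn_eq_false (hDN B (Or.inr hB))
    have h2 := ih D (N ++ [fourCorners (m :: ms)]) hLs (two_le_length_of_open m ms hDN)
    rw [ffdsLoop, hf, Timed.ffdsLoop_skip h]
    simpa using h2

theorem pairwise_sortUp (L : List ℝ) : (sortUp L).Pairwise (· ≤ ·) := by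
  have := List.pairwise_mergeSort (le := fun a b : ℝ => decide (a ≤ b))
    (by simpa using fun a b c => le_trans) (by simpa using le_total) L
  simpa [sortUp] using this

theorem pairwise_sortDown (L : List ℝ) : (sortDown L).Pairwise (· ≥ ·) := by
  have := List.pairwise_mergeSort (le := fun a b : ℝ => decide (b ≤ a))
    (by simp only [decide_eq_true_eq]; exact fun a b c h1 h2 => le_trans h2 h1)
    (by simpa using fun a b => le_total b a) L
  simpa [sortDown] using this

/-- The bins of FFDS are those of the recursion in the implementation, in the same order. This makes
`ffds_induction` available for all properties of FFDS. -/
theorem FFDS_eq (L : List ℝ) : FFDS L =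
    (Timed.ffdsLoop (sortUp (L.filter fun s => decide (1 / 2 < s)))
        (sortDown (L.filter fun s => decide (s ≤ 1 / 2)))).val.1 ++
      (Timed.ffdsLoop (sortUp (L.filter fun s => decide (1 / 2 < s)))
        (sortDown (L.filter fun s => decide (s ≤ 1 / 2)))).val.2 := by
  have := ffdsLoop_eq (sortUp (L.filter fun s => decide (1 / 2 < s)))
    (sortDown (L.filter fun s => decide (s ≤ 1 / 2))) [] [] (pairwise_sortUp _) (by simp)
  simpa [FFDS] using this

namespace Timed

theorem length_le_four_of_mem_ffdsLoop (Ls ms : List ℝ) :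
    ∀ B ∈ (ffdsLoop Ls ms).val.1 ++ (ffdsLoop Ls ms).val.2, B.length ≤ 4 := by
  induction Ls, ms using ffds_induction with
  | nil Ls => simp [ffdsLoop_nil]
  | none m ms ih =>
    intro B hB
    simp only [ffdsLoop_none, List.mem_append, List.mem_cons] at ih hB
    rcases hB with hB | rfl | hB
    · exact ih B (Or.inl hB)
    · simp
    · exact ih B (Or.inr hB)
  | pair l Ls m ms h ih =>
    intro B hB
    simp only [ffdsLoop_pair h, List.mem_append, List.mem_cons] at ih hB
    rcases hB with (rfl | hB) | hB
    · simp
    · exact ih B (Or.inl hB)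
    · exact ih B (Or.inr hB)
  | skip l Ls m ms h ih =>
    intro B hB
    simp only [ffdsLoop_skip h, List.mem_append, List.mem_cons] at ih hB
    rcases hB with hB | rfl | hB
    · exact ih B (Or.inl hB)
    · simp
    · exact ih B (Or.inr hB)

@[simp] theorem FFDS_val (L : List ℝ) : (FFDS L).val = SquareMinSum.FFDS L := by
  simp [FFDS_eq, FFDS]

@[simp] theorem countCmp_val (B B' : Bin) :
    (countCmp B B').val = decide (B'.length ≤ B.length) := by
  simp [countCmp]

@[simp] theorem sortByCount_val (P : List Bin) :
    (sortByCount P).val = SquareMinSum.sortByCount P := by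
  simp [sortByCount, SquareMinSum.sortByCount]

theorem algorithm_val (I : List ℝ) : (algorithm I).val = SquareMinSum.algorithm I := by
  simp [algorithm, SquareMinSum.algorithm]

end Timed

theorem length_filter_add_length_filter (L : List ℝ) :
    (L.filter fun s => decide (1 / 2 < s)).length + (L.filter fun s => decide (s ≤ 1 / 2)).length
      = L.length := by
  have : (fun s : ℝ => decide (s ≤ 1 / 2)) = fun s => !decide (1 / 2 < s) := by
    funext s; simp [← decide_not]
  rw [this]
  exact (List.length_eq_length_filter_add _).symm

theorem length_FFDS_le (L : List ℝ) : (FFDS L).length ≤ L.length := by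
  have h := Timed.length_ffdsLoop (sortUp (L.filter fun s => decide (1 / 2 < s)))
    (sortDown (L.filter fun s => decide (s ≤ 1 / 2)))
  rw [Timed.length_sortUp, Timed.length_sortDown] at h
  have := length_filter_add_length_filter L
  rw [FFDS_eq, List.length_append]
  omega

theorem length_packSmall_le (I : List ℝ) :
    (packSmall I).length ≤ I.length := by
  have h : ∀ gs : List (List ℝ), (gs.flatMap fun G =>
      NFDH (G.filter fun s => decide (s ≤ 1 / 3))).length ≤ gs.flatten.length := by
    intro gs
    induction gs with
    | nil => simp
    | cons G gs ih =>
      have h1 := length_NFDH_le (G.filter fun s => decide (s ≤ 1 / 3))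
      have h2 : (G.filter fun s => decide (s ≤ 1 / 3)).length ≤ G.length :=
        List.length_filter_le _ _
      simp only [List.flatMap_cons, List.flatten_cons, List.length_append]
      omega
  exact (h _).trans (flatten_groups_perm I).length_eq.le

namespace Timed

theorem FFDS_steps (L : List ℝ) :
    (FFDS L).steps ≤ 2 * (L.length * Nat.clog 2 L.length) + 34 * L.length + 14 := by
  have hsum := length_filter_add_length_filter L
  have h1 := filter_steps (fun s => lt (1 / 2) s) (fun _ => rfl) L
  have h2 := filter_steps (fun s => le s (1 / 2)) (fun _ => rfl) L
  have h3 := sortUp_steps (L.filter fun s => decide (1 / 2 < s))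
  have h4 := sortDown_steps (L.filter fun s => decide (s ≤ 1 / 2))
  have h5 := ffdsLoop_steps (SquareMinSum.sortUp (L.filter fun s => decide (1 / 2 < s)))
    (SquareMinSum.sortDown (L.filter fun s => decide (s ≤ 1 / 2)))
  have h6 := (length_ffdsLoop (SquareMinSum.sortUp (L.filter fun s => decide (1 / 2 < s)))
    (SquareMinSum.sortDown (L.filter fun s => decide (s ≤ 1 / 2)))).1
  rw [length_sortUp, length_sortDown] at h5
  rw [length_sortUp] at h6
  simp only [FFDS, bind_steps, tick_steps, filter_val, lt_val, le_val, sortUp_val, sortDown_val,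
    append_steps, h1, h2, h6]
  generalize (L.filter fun s => decide (1 / 2 < s)).length = u at *
  generalize (L.filter fun s => decide (s ≤ 1 / 2)).length = v at *
  have h7 : u * Nat.clog 2 u ≤ u * Nat.clog 2 L.length :=
    Nat.mul_le_mul_left _ (Nat.clog_mono_right _ (by omega))
  have h8 : v * Nat.clog 2 v ≤ v * Nat.clog 2 L.length :=
    Nat.mul_le_mul_left _ (Nat.clog_mono_right _ (by omega))
  have h9 : L.length * Nat.clog 2 L.length
      = u * Nat.clog 2 L.length + v * Nat.clog 2 L.length := by rw [← add_mul, hsum]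
  rw [h9]
  omega

theorem sortByCount_steps (L : List ℝ) : (sortByCount (SquareMinSum.FFDS L)).steps ≤
    21 * (L.length * Nat.clog 2 L.length) + 8 * L.length + 4 := by
  have h1 := mergeSort_steps countCmp 20 (SquareMinSum.FFDS L) (by
    intro B hB B' hB'
    rw [FFDS_eq] at hB hB'
    have := length_le_four_of_mem_ffdsLoop _ _ B hB
    have := length_le_four_of_mem_ffdsLoop _ _ B' hB'
    simp [countCmp]
    omega)
  have h2 := length_FFDS_le L
  have h3 : (SquareMinSum.FFDS L).length * Nat.clog 2 (SquareMinSum.FFDS L).length ≤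
      L.length * Nat.clog 2 L.length := Nat.mul_le_mul h2 (Nat.clog_mono_right _ h2)
  simp only [sortByCount, bind_steps, tick_steps]
  omega

theorem algorithm_steps (I : List ℝ) :
    (algorithm I).steps ≤ 27 * (I.length * Nat.clog 2 I.length) + 84 * I.length + 29 := by
  have h1 := packSmall_steps I
  have h2 := filter_steps (fun s => lt (1 / 3) s) (fun _ => rfl) I
  have h3 := FFDS_steps (I.filter fun s => decide (1 / 3 < s))
  have h4 := sortByCount_steps (I.filter fun s => decide (1 / 3 < s))
  have h5 := length_packSmall_le I
  have h6 : (I.filter fun s => decide (1 / 3 < s)).length ≤ I.length := List.length_filter_le _ _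
  have h7 := Nat.mul_le_mul h6 (Nat.clog_mono_right 2 h6)
  simp only [algorithm, bind_steps, tick_steps, packSmall_val, filter_val, lt_val, FFDS_val,
    append_steps, h2]
  omega

/-- The linear terms are absorbed since `n log n ≥ n log 2`. -/
theorem exists_steps_le : ∃ C : ℝ, ∀ I : List ℝ, 2 ≤ I.length →
    ((algorithm I).steps : ℝ) ≤ C * ((I.length : ℝ) * Real.log (I.length : ℝ)) := by
  refine ⟨153 / Real.log 2, fun I hI => ?_⟩
  have h1 : ((algorithm I).steps : ℝ) ≤
      27 * (I.length * Nat.clog 2 I.length) + 84 * I.length + 29 := by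
    exact_mod_cast algorithm_steps I
  have hl2 : 0 < Real.log 2 := Real.log_pos (by norm_num)
  have hn : (2 : ℝ) ≤ I.length := by exact_mod_cast hI
  have hl : Real.log 2 ≤ Real.log I.length := Real.log_le_log (by norm_num) hn
  -- `⌈log₂ n⌉ ≤ log₂ n + 1 ≤ 2 log₂ n`
  have hc : (Nat.clog 2 I.length : ℝ) * Real.log 2 ≤ 2 * Real.log I.length := by
    have h3 : Nat.clog 2 I.length ≤ Nat.log 2 I.length + 1 :=
      Nat.clog_le_of_le_pow (Nat.lt_pow_succ_log_self (by norm_num) _).le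
    have h4 : (2 : ℝ) ^ Nat.log 2 I.length ≤ I.length := by
      exact_mod_cast Nat.pow_log_le_self 2 (by omega)
    have h5 := Real.log_le_log (by positivity) h4
    rw [Real.log_pow] at h5
    have h6 : (Nat.clog 2 I.length : ℝ) ≤ Nat.log 2 I.length + 1 := by exact_mod_cast h3
    nlinarith
  rw [div_mul_eq_mul_div, le_div_iff₀ hl2]
  generalize (Nat.clog 2 I.length : ℝ) = c at *
  generalize (I.length : ℝ) = n at *
  have h7 : n * (c * Real.log 2) ≤ n * (2 * Real.log n) := by gcongr
  have h8 : n * Real.log 2 ≤ n * Real.log n := by gcongr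
  have h9 := mul_le_mul_of_nonneg_right h1 hl2.le
  nlinarith

end Timed

/-! ### Squares in the unit bin -/

theorem disjoint_internal_of_sep {p q : PlacedSquare}
    (h : p.x + p.size ≤ q.x ∨ q.x + q.size ≤ p.x ∨ p.y + p.size ≤ q.y ∨ q.y + q.size ≤ p.y) :
    Disjoint p.internal q.internal := by
  rw [Set.disjoint_left]
  rintro ⟨u, v⟩ ⟨⟨h1, h2⟩, h3, h4⟩ ⟨⟨h5, h6⟩, h7, h8⟩
  simp only at h1 h2 h3 h4 h5 h6 h7 h8
  rcases h with h | h | h | h <;> linarith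

theorem region_subset {p : PlacedSquare} (hx : 0 ≤ p.x) (hy : 0 ≤ p.y) (hx' : p.x + p.size ≤ 1)
    (hy' : p.y + p.size ≤ 1) : p.region ⊆ Set.Icc (0 : ℝ) 1 ×ˢ Set.Icc (0 : ℝ) 1 :=
  Set.prod_mono (Set.Icc_subset_Icc hx hx') (Set.Icc_subset_Icc hy hy')

theorem bounds_of_region_subset {p : PlacedSquare} (hs : 0 < p.size)
    (h : p.region ⊆ Set.Icc (0 : ℝ) 1 ×ˢ Set.Icc (0 : ℝ) 1) :
    0 ≤ p.x ∧ 0 ≤ p.y ∧ p.x + p.size ≤ 1 ∧ p.y + p.size ≤ 1 := by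
  have h1 := h (show (p.x, p.y) ∈ p.region by constructor <;> constructor <;> simp [hs.le])
  have h2 := h (show (p.x + p.size, p.y + p.size) ∈ p.region by
    constructor <;> constructor <;> simp [hs.le])
  exact ⟨h1.1.1, h1.2.1, h2.1.2, h2.2.2⟩

/-- Two squares in a common bin are next to each other or on top of each other, so that their sizes
add up to at most `1`. -/
theorem size_add_size_le {p q : PlacedSquare} (hp : 0 < p.size) (hq : 0 < q.size)
    (hp' : p.region ⊆ Set.Icc (0 : ℝ) 1 ×ˢ Set.Icc (0 : ℝ) 1)
    (hq' : q.region ⊆ Set.Icc (0 : ℝ) 1 ×ˢ Set.Icc (0 : ℝ) 1)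
    (h : Disjoint p.internal q.internal) : p.size + q.size ≤ 1 := by
  obtain ⟨h1, h2, h3, h4⟩ := bounds_of_region_subset hp hp'
  obtain ⟨h5, h6, h7, h8⟩ := bounds_of_region_subset hq hq'
  rw [PlacedSquare.internal, PlacedSquare.internal, Set.disjoint_prod, Set.Ioo_disjoint_Ioo,
    Set.Ioo_disjoint_Ioo] at h
  rcases h with h | h
  · rcases min_le_iff.1 h with h | h <;> rcases le_max_iff.1 h with h | h <;> linarith
  · rcases min_le_iff.1 h with h | h <;> rcases le_max_iff.1 h with h | h <;> linarith

theorem pairwise_size_add_size_le {B : Bin} (hB : FeasibleBin B) (hpos : ∀ p ∈ B, 0 < p.size) :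
    B.Pairwise fun p q => p.size + q.size ≤ 1 :=
  hB.2.imp_of_mem fun hp hq h =>
    size_add_size_le (hpos _ hp) (hpos _ hq) (hB.1 _ hp) (hB.1 _ hq) h

/-- Every square of size greater than `1/3` in the unit bin has one of the four points with
coordinates in `{1/3, 2/3}` in its interior. -/
theorem length_le_four_of_feasibleBin {B : Bin} (hB : FeasibleBin B)
    (hbig : ∀ p ∈ B, 1 / 3 < p.size) : B.length ≤ 4 := by
  classical
  set f : PlacedSquare → Bool × Bool := fun p => (decide (p.x < 1 / 3), decide (p.y < 1 / 3))
  have hnd : (B.map f).Nodup := by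
    rw [List.Nodup, List.pairwise_map]
    refine hB.2.imp_of_mem ?_
    intro p q hp hq hpq hf
    have h1 := hbig p hp
    have h2 := hbig q hq
    obtain ⟨a1, a2, a3, a4⟩ := bounds_of_region_subset (by linarith) (hB.1 p hp)
    obtain ⟨b1, b2, b3, b4⟩ := bounds_of_region_subset (by linarith) (hB.1 q hq)
    simp only [f, Prod.mk.injEq, decide_eq_decide] at hf
    have key : ∀ u v s t : ℝ, 0 ≤ u → 0 ≤ v → u + s ≤ 1 → v + t ≤ 1 → 1 / 3 < s → 1 / 3 < t →
        (u < 1 / 3 ↔ v < 1 / 3) → ∃ z, u < z ∧ z < u + s ∧ v < z ∧ z < v + t := by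
      intro u v s t _ _ _ _ _ _ huv
      by_cases hu : u < 1 / 3
      · exact ⟨1 / 3, hu, by linarith, huv.1 hu, by linarith⟩
      · have hv : 1 / 3 ≤ v := not_lt.1 fun hv => hu (huv.2 hv)
        rw [not_lt] at hu
        exact ⟨2 / 3, by linarith, by linarith, by linarith, by linarith⟩
    obtain ⟨z, z1, z2, z3, z4⟩ := key p.x q.x p.size q.size a1 b1 a3 b3 h1 h2 hf.1
    obtain ⟨t, t1, t2, t3, t4⟩ := key p.y q.y p.size q.size a2 b2 a4 b4 h1 h2 hf.2
    exact Set.disjoint_left.1 hpq (show (z, t) ∈ p.internal from ⟨⟨z1, z2⟩, t1, t2⟩)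
      ⟨⟨z3, z4⟩, t3, t4⟩
  simpa using hnd.length_le_card

theorem FeasibleBin.sublist {B B' : Bin} (hB : FeasibleBin B) (h : B'.Sublist B) :
    FeasibleBin B' :=
  ⟨fun p hp => hB.1 p (h.subset hp), hB.2.sublist h⟩

theorem area_nonneg (C : List ℝ) : 0 ≤ area C :=
  List.sum_nonneg fun x hx => by
    obtain ⟨s, -, rfl⟩ := List.mem_map.1 hx
    positivity

open MeasureTheory in
theorem area_le_one_of_feasibleBin {B : Bin} (hB : FeasibleBin B) (hpos : ∀ p ∈ B, 0 < p.size) :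
    area (B.map PlacedSquare.size) ≤ 1 := by
  have hmeas : ∀ p : PlacedSquare, MeasurableSet p.internal := fun p =>
    measurableSet_Ioo.prod measurableSet_Ioo
  have hvol : ∀ p : PlacedSquare, 0 < p.size →
      volume p.internal = ENNReal.ofReal (p.size ^ 2) := by
    intro p hp
    rw [PlacedSquare.internal, Measure.volume_eq_prod, Measure.prod_prod, Real.volume_Ioo,
      Real.volume_Ioo, ← ENNReal.ofReal_mul (by linarith)]
    congr 1
    ring
  have hsum : ∀ C : Bin, (∀ p ∈ C, 0 < p.size) →
      C.Pairwise (fun p q => Disjoint p.internal q.internal) →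
      volume (⋃ p ∈ C, p.internal) = ENNReal.ofReal (area (C.map PlacedSquare.size)) := by
    intro C
    induction C with
    | nil => simp [area]
    | cons p C ih =>
      intro h1 h2
      have ih' := ih (fun q hq => h1 q (by simp [hq])) h2.of_cons
      have hd : Disjoint p.internal (⋃ q ∈ C, q.internal) := by
        simp only [Set.disjoint_iUnion_right]
        exact fun q hq => List.rel_of_pairwise_cons h2 hq
      have hm : MeasurableSet (⋃ q ∈ C, q.internal) :=
        MeasurableSet.biUnion (List.finite_toSet C).countable fun q _ => hmeas q
      have e : (⋃ q ∈ p :: C, q.internal) = p.internal ∪ ⋃ q ∈ C, q.internal := by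
        simp [Set.iUnion_or, Set.iUnion_union_distrib]
      rw [e, measure_union hd hm, ih', hvol p (h1 p (by simp)), ← ENNReal.ofReal_add]
      · simp [area]
      · positivity
      · exact area_nonneg _
  have hsub : (⋃ p ∈ B, p.internal) ⊆ Set.Icc (0 : ℝ) 1 ×ˢ Set.Icc (0 : ℝ) 1 := by
    simp only [Set.iUnion_subset_iff]
    exact fun p hp => (Set.prod_mono Set.Ioo_subset_Icc_self Set.Ioo_subset_Icc_self).trans
      (hB.1 p hp)
  have h1 := measure_mono (μ := volume) hsub
  rw [hsum B hpos hB.2, Measure.volume_eq_prod, Measure.prod_prod, Real.volume_Icc] at h1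
  simpa using h1

/-! ### The algorithm returns a feasible packing -/

theorem FeasibleBin.cons {B : Bin} {p : PlacedSquare} (hB : FeasibleBin B)
    (hp : p.region ⊆ Set.Icc (0 : ℝ) 1 ×ˢ Set.Icc (0 : ℝ) 1)
    (h : ∀ q ∈ B, Disjoint p.internal q.internal) : FeasibleBin (p :: B) :=
  ⟨List.forall_mem_cons.2 ⟨hp, hB.1⟩, List.pairwise_cons.2 ⟨h, hB.2⟩⟩

theorem feasibleBin_single {s : ℝ} (h1 : s ≤ 1) : FeasibleBin [bottomLeft s] :=
  ⟨List.forall_mem_singleton.2 (region_subset le_rfl le_rfl (by simpa [bottomLeft] using h1)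
    (by simpa [bottomLeft] using h1)), List.pairwise_singleton _ _⟩

/-- The hypothesis `hin` describes the current bin: no square exceeds the top `y + h` of the current
level, and a square either lies below this level or within its first `w` units. -/
theorem feasible_nextFitLevels (L : List ℝ) (B : Bin) (y h w : ℝ) (hB : FeasibleBin B)
    (hin : ∀ p ∈ B, p.y + p.size ≤ y + h ∧ (p.y + p.size ≤ y ∨ p.x + p.size ≤ w))
    (hy : 0 ≤ y) (hh : 0 ≤ h) (hw : 0 ≤ w) (hyh : y + h ≤ 1) (hL : L.Pairwise (· ≥ ·))
    (hLh : ∀ s ∈ L, 0 < s ∧ s ≤ h) (B' : Bin) (hB' : B' ∈ nextFitLevels B y h w L) :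
    FeasibleBin B' := by
  induction L generalizing B y h w with
  | nil =>
    obtain rfl : B' = B := by simpa [nextFitLevels] using hB'
    exact hB
  | cons s L ih =>
    obtain ⟨hs0, hsh⟩ := hLh s (by simp)
    have hLs : ∀ t ∈ L, 0 < t ∧ t ≤ s := fun t ht =>
      ⟨(hLh t (by simp [ht])).1, List.rel_of_pairwise_cons hL ht⟩
    rw [nextFitLevels] at hB'
    split_ifs at hB' with h1 h2
    · refine ih _ _ _ _ (hB.cons (region_subset hw hy h1 (by simp only; linarith)) ?_) ?_
        hy hh (by linarith) hyh hL.of_cons (fun t ht => hLh t (by simp [ht])) hB'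
      · intro p hp
        refine disjoint_internal_of_sep ?_
        rcases (hin p hp).2 with h | h <;> simp [h]
      · intro p hp
        rcases List.mem_cons.1 hp with rfl | hp
        · exact ⟨by simp only; linarith, Or.inr le_rfl⟩
        · exact ⟨(hin p hp).1, (hin p hp).2.imp_right fun h => by linarith⟩
    · refine ih _ _ _ _ (hB.cons (region_subset le_rfl (by simp only; linarith)
        (by simp only; linarith) h2) ?_) ?_ (by linarith) hs0.le hs0.le (by linarith)
        hL.of_cons hLs hB'
      · intro p hp
        refine disjoint_internal_of_sep ?_
        simp [(hin p hp).1]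
      · intro p hp
        rcases List.mem_cons.1 hp with rfl | hp
        · exact ⟨le_rfl, Or.inr (by simp)⟩
        · exact ⟨by linarith [(hin p hp).1], Or.inl (hin p hp).1⟩
    · rcases List.mem_cons.1 hB' with rfl | hB'
      · exact hB
      · refine ih _ _ _ _ (feasibleBin_single (by linarith)) ?_ le_rfl hs0.le hs0.le
          (by linarith) hL.of_cons hLs hB'
        simp [bottomLeft]

theorem flatten_nextFitLevels_perm (L : List ℝ) (B : Bin) (y h w : ℝ) :
    ((nextFitLevels B y h w L).flatten.map PlacedSquare.size).Perm
      (B.map PlacedSquare.size ++ L) := by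
  induction L generalizing B y h w with
  | nil => simp [nextFitLevels]
  | cons s L ih =>
    rw [nextFitLevels]
    split_ifs with h1 h2
    · exact (ih _ _ _ _).trans (by simpa using List.perm_middle.symm)
    · exact (ih _ _ _ _).trans (by simpa using List.perm_middle.symm)
    · rw [List.flatten_cons, List.map_append]
      exact (ih _ _ _ _).append_left _

theorem flatten_NFDH_perm (L : List ℝ) : ((NFDH L).flatten.map PlacedSquare.size).Perm L := by
  refine List.Perm.trans ?_ (sortDown_perm L)
  unfold NFDH
  cases sortDown L with
  | nil => simp [nextFitStart]
  | cons s L => simpa [nextFitStart] using flatten_nextFitLevels_perm L [⟨s, 0, 0⟩] 0 s s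

theorem feasible_NFDH {L : List ℝ} (hL : IsInstance L) (B : Bin) (hB : B ∈ NFDH L) :
    FeasibleBin B := by
  have h1 : ∀ s ∈ sortDown L, 0 < s ∧ s ≤ 1 := fun s hs => hL s ((sortDown_perm L).mem_iff.1 hs)
  have h2 := pairwise_sortDown L
  unfold NFDH at hB
  cases h : sortDown L with
  | nil => simp [h, nextFitStart] at hB
  | cons s rest =>
    rw [h] at hB h1 h2
    have hs := h1 s (by simp)
    refine feasible_nextFitLevels rest [⟨s, 0, 0⟩] 0 s s (feasibleBin_single hs.2) (by simp)
      le_rfl hs.1.le hs.1.le (by linarith) h2.of_cons (fun t ht => ⟨(h1 t (by simp [ht])).1,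
        List.rel_of_pairwise_cons h2 ht⟩) B hB

theorem IsInstance.filter {L : List ℝ} (hL : IsInstance L) (p : ℝ → Bool) :
    IsInstance (L.filter p) := fun s hs => hL s (List.mem_of_mem_filter hs)

theorem isInstance_of_mem_groups {I : List ℝ} (hI : IsInstance I) {G : List ℝ}
    (hG : G ∈ groups I) : IsInstance G := fun s hs =>
  hI s ((flatten_groups_perm I).mem_iff.1 (List.mem_flatten.2 ⟨G, hG, hs⟩))

theorem packSmall_perm (I : List ℝ) : ((packSmall I).flatten.map PlacedSquare.size).Perm
    (I.filter fun s => decide (s ≤ 1 / 3)) := by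
  refine List.Perm.trans ?_ ((flatten_groups_perm I).filter _)
  unfold packSmall
  induction groups I with
  | nil => simp
  | cons G gs ih =>
    simp only [List.flatMap_cons, List.flatten_append, List.map_append, List.flatten_cons,
      List.filter_append]
    exact (flatten_NFDH_perm _).append ih

theorem feasible_packSmall {I : List ℝ} (hI : IsInstance I) (B : Bin) (hB : B ∈ packSmall I) :
    FeasibleBin B := by
  obtain ⟨G, hG, hB⟩ := List.mem_flatMap.1 hB
  exact feasible_NFDH ((isInstance_of_mem_groups hI hG).filter _) B hB

theorem map_size_fourCorners (L : List ℝ) :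
    (fourCorners L).map PlacedSquare.size = L.take 4 := by
  rcases L with _ | ⟨a, _ | ⟨b, _ | ⟨c, _ | ⟨d, L⟩⟩⟩⟩ <;>
    simp [fourCorners, bottomLeft, bottomRight, topLeft, topRight]

theorem map_size_threeCorners (L : List ℝ) :
    (threeCorners L).map PlacedSquare.size = L.take 3 := by
  rcases L with _ | ⟨a, _ | ⟨b, _ | ⟨c, L⟩⟩⟩ <;>
    simp [threeCorners, bottomRight, topLeft, topRight]

theorem ffdsLoop_perm (Ls ms : List ℝ) :
    ((((Timed.ffdsLoop Ls ms).val.1 ++ (Timed.ffdsLoop Ls ms).val.2).flatten).map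
      PlacedSquare.size).Perm (Ls ++ ms) := by
  induction Ls, ms using ffds_induction with
  | nil Ls =>
    rw [Timed.ffdsLoop_nil]
    induction Ls with
    | nil => simp
    | cons l Ls ih => simpa [bottomLeft] using ih
  | none m ms ih =>
    rw [Timed.ffdsLoop_none]
    simp only [List.flatten_append, List.map_append, List.flatten_cons,
      map_size_fourCorners, List.nil_append, List.take_succ_cons] at ih ⊢
    refine (List.perm_append_comm_assoc _ _ _).trans ?_
    refine (ih.append_left _).trans ?_
    simp
  | pair l Ls m ms h ih =>
    rw [Timed.ffdsLoop_pair h]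
    simp only [List.flatten_append, List.map_append, List.flatten_cons, List.map_cons,
      List.cons_append, map_size_threeCorners, List.take_succ_cons] at ih ⊢
    refine ((ih.append_left _).cons _).cons l |>.trans ?_
    refine List.Perm.cons l ?_
    refine List.Perm.trans ?_ List.perm_middle.symm
    refine List.Perm.cons m ?_
    refine (List.perm_append_comm_assoc _ _ _).trans ?_
    simp
  | skip l Ls m ms h ih =>
    rw [Timed.ffdsLoop_skip h]
    simp only [List.flatten_append, List.map_append, List.flatten_cons,
      map_size_fourCorners, List.take_succ_cons] at ih ⊢
    refine (List.perm_append_comm_assoc _ _ _).trans ?_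
    refine (ih.append_left _).trans ?_
    refine (List.perm_append_comm_assoc _ _ _).trans ?_
    simp

/-- Four squares of size at most `1/2` in the corners, or one square and three squares that fit
next to it and have size at most `1/2`. -/
theorem feasible_corners {a b c d : ℝ} (ha : 0 < a) (hb : 0 < b) (hab : a + b ≤ 1)
    (hac : a + c ≤ 1) (had : a + d ≤ 1) (hb' : b ≤ 1 / 2) (hc' : c ≤ 1 / 2) (hd' : d ≤ 1 / 2) :
    FeasibleBin [bottomLeft a, bottomRight b, topLeft c, topRight d] := by
  refine ⟨?_, ?_⟩
  · simp only [List.mem_cons, List.not_mem_nil, or_false, forall_eq_or_imp, forall_eq]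
    refine ⟨region_subset ?_ ?_ ?_ ?_, region_subset ?_ ?_ ?_ ?_, region_subset ?_ ?_ ?_ ?_,
      region_subset ?_ ?_ ?_ ?_⟩ <;> simp only [bottomLeft, bottomRight, topLeft, topRight] <;>
      linarith
  · simp only [List.pairwise_cons, List.mem_cons, List.not_mem_nil, or_false, forall_eq_or_imp,
      forall_eq, false_implies, implies_true, List.Pairwise.nil, and_true]
    refine ⟨⟨?_, ?_, ?_⟩, ⟨?_, ?_⟩, ?_⟩ <;> apply disjoint_internal_of_sep <;>
      simp only [bottomLeft, bottomRight, topLeft, topRight]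
    · left; linarith
    · right; right; left; linarith
    · left; linarith
    · right; right; left; linarith
    · right; right; left; linarith
    · left; linarith

theorem feasible_threeCorners {a : ℝ} (ha : 0 < a) (ha1 : a ≤ 1) (L : List ℝ)
    (hL : ∀ s ∈ L, 0 < s ∧ s ≤ 1 / 2 ∧ a + s ≤ 1) :
    FeasibleBin (bottomLeft a :: threeCorners L) := by
  rcases L with _ | ⟨b, _ | ⟨c, _ | ⟨d, L⟩⟩⟩
  · simpa [threeCorners] using feasibleBin_single ha1
  · obtain ⟨h1, h2, h3⟩ := hL b (by simp)
    refine (feasible_corners ha h1 h3 h3 h3 h2 h2 h2).sublist ?_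
    simp [threeCorners]
  · obtain ⟨h1, h2, h3⟩ := hL b (by simp)
    obtain ⟨h4, h5, h6⟩ := hL c (by simp)
    refine (feasible_corners ha h1 h3 h6 h6 h2 h5 h5).sublist ?_
    simp [threeCorners]
  · obtain ⟨h1, h2, h3⟩ := hL b (by simp)
    obtain ⟨h4, h5, h6⟩ := hL c (by simp)
    obtain ⟨h7, h8, h9⟩ := hL d (by simp)
    simpa [threeCorners] using feasible_corners ha h1 h3 h6 h9 h2 h5 h8

theorem feasible_fourCorners (m : ℝ) (L : List ℝ) (hL : ∀ s ∈ m :: L, 0 < s ∧ s ≤ 1 / 2) :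
    FeasibleBin (fourCorners (m :: L)) := by
  have hm := hL m (by simp)
  have e : fourCorners (m :: L) = bottomLeft m :: threeCorners L := by
    simp [fourCorners, threeCorners]
  rw [e]
  refine feasible_threeCorners hm.1 (by linarith) L fun s hs => ?_
  have := hL s (by simp [hs])
  exact ⟨this.1, this.2, by linarith⟩

theorem feasible_ffdsLoop (Ls ms : List ℝ) (hLs : ∀ s ∈ Ls, 0 < s ∧ s ≤ 1)
    (hms : ∀ s ∈ ms, 0 < s ∧ s ≤ 1 / 2) (hsort : ms.Pairwise (· ≥ ·)) :
    ∀ B ∈ (Timed.ffdsLoop Ls ms).val.1 ++ (Timed.ffdsLoop Ls ms).val.2, FeasibleBin B := by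
  induction Ls, ms using ffds_induction with
  | nil Ls =>
    simp only [Timed.ffdsLoop_nil, List.append_nil, List.mem_map]
    rintro _ ⟨s, hs, rfl⟩
    exact feasibleBin_single (hLs s hs).2
  | none m ms ih =>
    have ih := ih hLs (fun s hs => hms s (List.mem_cons_of_mem _ (List.mem_of_mem_drop hs)))
      (hsort.of_cons.sublist (List.drop_sublist _ _))
    have h4 := feasible_fourCorners m ms hms
    simp only [Timed.ffdsLoop_none, List.mem_append, List.mem_cons] at ih ⊢
    rintro B (hB | rfl | hB)
    exacts [ih B (Or.inl hB), h4, ih B (Or.inr hB)]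
  | pair l Ls m ms h ih =>
    have ih := ih (fun s hs => hLs s (by simp [hs]))
      (fun s hs => hms s (List.mem_cons_of_mem _ (List.mem_of_mem_drop hs)))
      (hsort.of_cons.sublist (List.drop_sublist _ _))
    have hl := hLs l (by simp)
    have h4 := feasible_threeCorners hl.1 hl.2 (m :: ms) (fun s hs => by
      have h1 := hms s hs
      have h2 : s ≤ m := by
        rcases List.mem_cons.1 hs with rfl | hs
        · exact le_rfl
        · exact List.rel_of_pairwise_cons hsort hs
      exact ⟨h1.1, h1.2, by linarith⟩)
    simp only [Timed.ffdsLoop_pair h, List.mem_append, List.mem_cons] at ih ⊢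
    rintro B ((rfl | hB) | hB)
    exacts [h4, ih B (Or.inl hB), ih B (Or.inr hB)]
  | skip l Ls m ms h ih =>
    have ih := ih hLs (fun s hs => hms s (List.mem_cons_of_mem _ (List.mem_of_mem_drop hs)))
      (hsort.of_cons.sublist (List.drop_sublist _ _))
    have h4 := feasible_fourCorners m ms hms
    simp only [Timed.ffdsLoop_skip h, List.mem_append, List.mem_cons] at ih ⊢
    rintro B (hB | rfl | hB)
    exacts [ih B (Or.inl hB), h4, ih B (Or.inr hB)]

theorem filter_append_filter_not_perm (L : List ℝ) (a : ℝ) :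
    ((L.filter fun s => decide (a < s)) ++ (L.filter fun s => decide (s ≤ a))).Perm L := by
  have : (fun s : ℝ => decide (s ≤ a)) = fun s => !decide (a < s) := by
    funext s; simp [← decide_not]
  rw [this]
  exact List.filter_append_perm _ _

theorem isPacking_FFDS {L : List ℝ} (hL : IsInstance L) : IsPacking L (FFDS L) := by
  have h1 := sortUp_perm (L.filter fun s => decide (1 / 2 < s))
  have h2 := sortDown_perm (L.filter fun s => decide (s ≤ 1 / 2))
  refine ⟨?_, ?_⟩
  · rw [FFDS_eq]
    refine feasible_ffdsLoop _ _ (fun s hs => hL.filter _ s (h1.mem_iff.1 hs)) (fun s hs => ?_)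
      (pairwise_sortDown _)
    have := List.mem_filter.1 (h2.mem_iff.1 hs)
    exact ⟨(hL s this.1).1, by simpa using this.2⟩
  · rw [FFDS_eq]
    exact (ffdsLoop_perm _ _).trans ((h1.append h2).trans (filter_append_filter_not_perm L _))

theorem sortByCount_perm (P : List Bin) : (sortByCount P).Perm P := List.mergeSort_perm _ _

theorem IsPacking.sortByCount {L : List ℝ} {P : List Bin} (h : IsPacking L P) :
    IsPacking L (sortByCount P) :=
  ⟨fun B hB => h.1 B ((sortByCount_perm P).mem_iff.1 hB),
    ((sortByCount_perm P).flatten.map _).trans h.2⟩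

theorem isPacking_algorithm {I : List ℝ} (hI : IsInstance I) : IsPacking I (algorithm I) := by
  have h1 := (isPacking_FFDS (hI.filter fun s => decide (1 / 3 < s))).sortByCount
  refine ⟨?_, ?_⟩
  · intro B hB
    rcases List.mem_append.1 hB with hB | hB
    · exact feasible_packSmall hI B hB
    · exact h1.1 B hB
  · unfold algorithm
    rw [List.flatten_append, List.map_append]
    refine ((packSmall_perm I).append h1.2).trans ?_
    exact List.perm_append_comm.trans (filter_append_filter_not_perm I _)

/-! ### The cost as a function of the numbers of items -/

/-- The cost `∑ⱼ j · lⱼ` of a packing whose bins hold `l = [l₁, l₂, …]` items. -/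
def countCost : List ℕ → ℕ
  | [] => 0
  | a :: l => a + l.sum + countCost l

theorem cost_eq_countCost (P : List Bin) : cost P = countCost (P.map List.length) := by
  induction P with
  | nil => simp [cost, countCost]
  | cons B P ih =>
    have h1 : (P.map List.length).sum = ∑ j : Fin P.length, (P.get j).length := by
      rw [← List.sum_ofFn]
      congr 1
      conv_lhs => rw [← List.ofFn_get P, List.map_ofFn]
      rfl
    simp only [List.map_cons, countCost, ← ih, h1]
    simp only [cost, List.length_cons, Fin.sum_univ_succ]
    simp [add_mul, Finset.sum_add_distrib]
    ring

theorem countCost_append (l l' : List ℕ) :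
    countCost (l ++ l') = countCost l + l.length * l'.sum + countCost l' := by
  induction l with
  | nil => simp [countCost]
  | cons a l ih => simp [countCost, ih]; ring

theorem countCost_map_add {α : Type*} (f g : α → ℕ) (P : List α) :
    countCost (P.map fun B => f B + g B) = countCost (P.map f) + countCost (P.map g) := by
  induction P with
  | nil => simp [countCost]
  | cons B P ih => simp [countCost, ih, List.sum_map_add]; ring

theorem sum_le_countCost (l : List ℕ) : l.sum ≤ countCost l := by
  cases l <;> simp [countCost]

/-- The item in bin `j` is counted once for each of the bins `1, …, j`. -/
theorem countCost_eq_sum (l : List ℕ) (K : ℕ) (h : l.length ≤ K) :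
    countCost l = ∑ j ∈ Finset.range K, (l.drop j).sum := by
  induction l generalizing K with
  | nil => simp [countCost]
  | cons a l ih =>
    obtain ⟨K, rfl⟩ : ∃ k, K = k + 1 := ⟨K - 1, by simp at h; omega⟩
    rw [Finset.sum_range_succ', countCost, ih K (by simpa using h)]
    simp
    ring

/-- A packing is cheaper than another one if its first `j` bins hold at least as many items, for
all `j`. -/
theorem countCost_le_of_take_sum_le {l l' : List ℕ}
    (h : ∀ j, (l.take j).sum ≤ (l'.take j).sum) (hs : l.sum = l'.sum) :
    countCost l' ≤ countCost l := by
  rw [countCost_eq_sum l (max l.length l'.length) (le_max_left _ _),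
    countCost_eq_sum l' (max l.length l'.length) (le_max_right _ _)]
  refine Finset.sum_le_sum fun j _ => ?_
  have h1 := List.sum_take_add_sum_drop l j
  have h2 := List.sum_take_add_sum_drop l' j
  have h3 := h j
  omega

/-- If no bin has more than nine items, then the `k`-th item lies in bin `⌈k/9⌉` at the earliest. -/
theorem mul_succ_le_countCost (l : List ℕ) (h : ∀ a ∈ l, a ≤ 9) :
    l.sum * (l.sum + 1) ≤ 18 * countCost l := by
  induction l with
  | nil => simp
  | cons a l ih =>
    have h1 := ih fun b hb => h b (by simp [hb])
    have h2 := h a (by simp)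
    simp only [List.sum_cons, countCost]
    have h3 : a * l.sum ≤ 9 * l.sum := Nat.mul_le_mul_right _ h2
    have h4 : a * a ≤ 9 * a := Nat.mul_le_mul_right _ h2
    nlinarith

/-! ### Next Fit Decreasing Height needs two bins per group -/

@[simp] theorem area_nil : area [] = 0 := by simp [area]

@[simp] theorem area_cons (s : ℝ) (L : List ℝ) : area (s :: L) = s ^ 2 + area L := by
  simp [area]

@[simp] theorem area_append (L L' : List ℝ) : area (L ++ L') = area L + area L' := by
  simp [area]

theorem area_perm {L L' : List ℝ} (h : L.Perm L') : area L = area L' := (h.map _).sum_eq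

theorem area_le_of_sublist {L L' : List ℝ} (h : L.Sublist L') : area L ≤ area L' := by
  induction h with
  | slnil => exact le_rfl
  | cons a _ ih => rw [area_cons]; nlinarith [sq_nonneg a]
  | cons_cons a _ ih => simpa using ih

theorem length_mul_sq_le_area {L : List ℝ} {b : ℝ} (hb : 0 ≤ b) (h : ∀ s ∈ L, b ≤ s) :
    L.length * b ^ 2 ≤ area L := by
  induction L with
  | nil => simp
  | cons s L ih =>
    have h1 := ih fun t ht => h t (by simp [ht])
    have h2 : b ^ 2 ≤ s ^ 2 := by gcongr; exact h s (by simp)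
    simp only [List.length_cons, area_cons]
    push_cast
    linarith

theorem area_le_length_mul_sq {L : List ℝ} {b : ℝ} (h : ∀ s ∈ L, 0 < s ∧ s ≤ b) :
    area L ≤ L.length * b ^ 2 := by
  induction L with
  | nil => simp
  | cons s L ih =>
    have h1 := ih fun t ht => h t (by simp [ht])
    have h2 : s ^ 2 ≤ b ^ 2 := by gcongr; exacts [(h s (by simp)).1.le, (h s (by simp)).2]
    simp only [List.length_cons, area_cons]
    push_cast
    linarith

/-- The first bin of the level packing. If the item `s` opens a second bin, then the area of the
first bin and `s` exceeds `a ^ 2 + (1 - a) ^ 2`, where `a` is the size of the first item: a level of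
height `h` that is followed by a level of height `h'` has area at least
`h ^ 2 - h' ^ 2 + h' * (1 - h)`, and these bounds telescope. As the sizes are at most `1/3`, there
also are at least three levels with at least three items each.

In terms of the current state, `harea` bounds the area of the completed levels and of the current
level, and `hcount` says that there are `l` completed levels with at least three items each and `c`
items in the current level. -/
theorem nextFitLevels_first_bin (L : List ℝ) (B : Bin) (y h w a : ℝ) (ha : a ≤ 1 / 3)
    (hha : h ≤ a) (hL : L.Pairwise (· ≥ ·)) (hLh : ∀ s ∈ L, 0 < s ∧ s ≤ h)
    (harea : ∀ t ∈ L, a ^ 2 + (1 - a) * (y + h - a) + (w - h) * t ≤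
      area (B.map PlacedSquare.size))
    (hcount : ∃ l c : ℕ, 3 * l + c ≤ B.length ∧ y ≤ l / 3 ∧ w ≤ c / 3) :
    (nextFitLevels B y h w L).length ≤ 1 ∨ ∃ s L₁ L₂, L = L₁ ++ s :: L₂ ∧
      (nextFitLevels B y h w L).length = 1 + (nextFitLevels [⟨s, 0, 0⟩] 0 s s L₂).length ∧
      a ^ 2 + (1 - a) ^ 2 < area (B.map PlacedSquare.size) + area L₁ + s ^ 2 ∧
      9 ≤ B.length + L₁.length := by
  induction L generalizing B y h w with
  | nil => simp [nextFitLevels]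
  | cons s L ih =>
    obtain ⟨hs0, hsh⟩ := hLh s (by simp)
    have hLs : ∀ t ∈ L, 0 < t ∧ t ≤ s := fun t ht =>
      ⟨(hLh t (by simp [ht])).1, List.rel_of_pairwise_cons hL ht⟩
    obtain ⟨l, c, hlc, hyl, hwc⟩ := hcount
    have hs := harea s (by simp)
    rw [nextFitLevels]
    split_ifs with h1 h2
    · rcases ih (⟨s, w, y⟩ :: B) y h (w + s) hha hL.of_cons (fun t ht => hLh t (by simp [ht]))
        (fun t ht => by
          have h3 := harea t (by simp [ht])
          have h4 := hLs t ht
          simp only [List.map_cons, area_cons]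
          nlinarith)
        ⟨l, c + 1, by simp; omega, hyl, by push_cast; linarith⟩ with h3 | h3
      · exact Or.inl h3
      · obtain ⟨u, L₁, L₂, e, h4, h5, h6⟩ := h3
        refine Or.inr ⟨u, s :: L₁, L₂, by simp [e], h4, ?_, ?_⟩
        · simp only [List.map_cons, area_cons] at h5 ⊢
          linarith
        · simp only [List.length_cons] at h6 ⊢
          omega
    · -- the level is closed: it has at least three items, and its bound becomes part of the sum
      have hc : 3 ≤ c := by
        have : (2 : ℝ) < c := by linarith
        have : 2 < c := by exact_mod_cast this
        omega
      have key : a ^ 2 + (1 - a) * (y + h + s - a) ≤ area (B.map PlacedSquare.size) + s ^ 2 := by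
        nlinarith
      rcases ih (⟨s, 0, y + h⟩ :: B) (y + h) s s (by linarith) hL.of_cons hLs
        (fun t ht => by
          simp only [List.map_cons, area_cons]
          linarith)
        ⟨l + 1, 1, by simp; omega, by push_cast; linarith, by push_cast; linarith⟩ with h3 | h3
      · exact Or.inl h3
      · obtain ⟨u, L₁, L₂, e, h4, h5, h6⟩ := h3
        refine Or.inr ⟨u, s :: L₁, L₂, by simp [e], h4, ?_, ?_⟩
        · simp only [List.map_cons, area_cons] at h5 ⊢
          linarith
        · simp only [List.length_cons] at h6 ⊢
          omega
    · refine Or.inr ⟨s, [], L, rfl, by simp [add_comm], ?_, ?_⟩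
      · simp only [area_nil]
        nlinarith
      · have hc : (2 : ℝ) < c := by linarith
        have hl : (1 : ℝ) < l := by linarith
        have hc : 2 < c := by exact_mod_cast hc
        have hl : 1 < l := by exact_mod_cast hl
        omega

/-- With three bins, whose first items have sizes `a ≥ b ≥ c`, the area without `a ^ 2` would exceed
`(1 - a) ^ 2 + (1 - b) ^ 2`, which is at least `1` for `b ≤ 1/4`; and it would exceed
`8 * b ^ 2 + b ^ 2 + (1 - b) ^ 2`, as the first bin has at least nine items, and this is at least
`1` for `b ≥ 1/5`. -/
theorem length_nextFitStart_le_two {L : List ℝ} (hL : L.Pairwise (· ≥ ·))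
    (h3 : ∀ s ∈ L, 0 < s ∧ s ≤ 1 / 3) (harea : area L.tail ≤ 1) :
    (nextFitStart L).length ≤ 2 := by
  rcases L with _ | ⟨a, L⟩
  · simp [nextFitStart]
  rw [List.tail_cons] at harea
  have start : ∀ (a : ℝ) (L : List ℝ), (a :: L).Pairwise (· ≥ ·) →
      (∀ s ∈ a :: L, 0 < s ∧ s ≤ 1 / 3) → (nextFitLevels [⟨a, 0, 0⟩] 0 a a L).length ≤ 1 ∨
      ∃ s L₁ L₂, L = L₁ ++ s :: L₂ ∧ (nextFitLevels [⟨a, 0, 0⟩] 0 a a L).length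
        = 1 + (nextFitLevels [⟨s, 0, 0⟩] 0 s s L₂).length ∧
      (1 - a) ^ 2 < area L₁ + s ^ 2 ∧ 8 ≤ L₁.length := by
    intro a L hL h3
    have ha := h3 a (by simp)
    rcases nextFitLevels_first_bin L [⟨a, 0, 0⟩] 0 a a a ha.2 le_rfl hL.of_cons
      (fun s hs => ⟨(h3 s (by simp [hs])).1, List.rel_of_pairwise_cons hL hs⟩)
      (fun t _ => by simp) ⟨0, 1, by simp, by simp, by simpa using ha.2⟩ with h | h
    · exact Or.inl h
    · obtain ⟨s, L₁, L₂, h4, h5, h6, h7⟩ := h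
      refine Or.inr ⟨s, L₁, L₂, h4, h5, ?_, ?_⟩
      · simp only [List.map_cons, List.map_nil, area_cons, area_nil] at h6
        linarith
      · simp only [List.length_cons, List.length_nil] at h7
        omega
  rw [nextFitStart]
  rcases start a L hL h3 with h | ⟨b, L₁, L₂, rfl, h4, h5, h6⟩
  · omega
  have hsub : (b :: L₂).Sublist (a :: (L₁ ++ b :: L₂)) :=
    (List.sublist_append_right _ _).cons _
  rcases start b L₂ (hL.sublist hsub) (fun s hs => h3 s (hsub.subset hs)) with
    h | ⟨c, L₃, L₄, rfl, h7, h8, h9⟩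
  · omega
  exfalso
  obtain ⟨ha0, ha1⟩ := h3 a (by simp)
  obtain ⟨hb0, hb1⟩ := h3 b (by simp)
  have hmin : ∀ s ∈ L₁, b ≤ s := fun s hs =>
    (List.pairwise_append.1 hL.of_cons).2.2 s hs b (by simp)
  have h10 := length_mul_sq_le_area hb0.le hmin
  have h11 : (8 : ℝ) ≤ L₁.length := by exact_mod_cast h6
  have h12 : 8 * b ^ 2 ≤ L₁.length * b ^ 2 := by gcongr
  have h13 := area_nonneg L₄
  simp only [area_append, area_cons] at harea
  by_cases hb : b ≤ 1 / 4
  · nlinarith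
  · nlinarith

/-! ### The groups -/

theorem flatten_map_reverse_groupsFrom (G L : List ℝ) :
    ((groupsFrom G L).map List.reverse).flatten = G.reverse ++ L := by
  induction L generalizing G with
  | nil => cases G <;> simp [groupsFrom]
  | cons s L ih => rw [groupsFrom]; split_ifs <;> simp [ih]

theorem flatten_map_reverse_groups (I : List ℝ) :
    ((groups I).map List.reverse).flatten = sortUp I := by
  simp [groups, flatten_map_reverse_groupsFrom]

/-- The groups list their items in non-increasing order, so that the tail of a group consists of the
items that it held before its last item was added. -/
theorem area_tail_le_one (G L : List ℝ) (hG : area G ≤ 1) :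
    ∀ H ∈ groupsFrom G L, area H.tail ≤ 1 := by
  induction L generalizing G with
  | nil =>
    cases G with
    | nil => simp [groupsFrom]
    | cons a G =>
      simp only [area_cons] at hG
      simp only [groupsFrom, List.mem_singleton, forall_eq, List.tail_cons]
      nlinarith [sq_nonneg a]
  | cons s L ih =>
    rw [groupsFrom]
    split_ifs with h
    · simpa [hG] using ih [] (by simp)
    · exact ih _ (not_lt.1 h)

theorem one_lt_area_of_mem_dropLast (G L : List ℝ) :
    ∀ H ∈ (groupsFrom G L).dropLast, 1 < area H := by
  induction L generalizing G with
  | nil => cases G <;> simp [groupsFrom]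
  | cons s L ih =>
    rw [groupsFrom]
    split_ifs with h
    · intro H hH
      rcases List.mem_cons.1 (List.mem_of_mem_dropLast hH) with rfl | hH'
      · exact h
      · rcases h' : groupsFrom [] L with _ | ⟨x, l⟩
        · simp [h'] at hH'
        · rw [h', List.dropLast_cons_cons, ← h'] at hH
          rcases List.mem_cons.1 hH with rfl | hH
          · exact h
          · exact ih [] H hH
    · exact ih _

theorem pairwise_of_mem_groups {I G : List ℝ} (hG : G ∈ groups I) : G.Pairwise (· ≥ ·) := by
  have h := pairwise_sortUp I
  rw [← flatten_map_reverse_groups, List.pairwise_flatten] at h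
  have := h.1 G.reverse (List.mem_map_of_mem hG)
  exact List.pairwise_reverse.1 this

theorem area_tail_filter_le (p : ℝ → Bool) (G : List ℝ) :
    area (G.filter p).tail ≤ area G.tail := by
  cases G with
  | nil => simp
  | cons s G =>
    have h := area_le_of_sublist (List.filter_sublist (p := p) (l := G))
    rw [List.filter_cons]
    split_ifs
    · exact h
    · exact (area_le_of_sublist (List.tail_sublist _)).trans h

theorem area_tail_le_one_of_mem_groups {I G : List ℝ} (hG : G ∈ groups I) : area G.tail ≤ 1 :=
  area_tail_le_one [] _ (by simp) G hG

theorem sortDown_of_pairwise {L : List ℝ} (h : L.Pairwise (· ≥ ·)) : sortDown L = L :=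
  List.mergeSort_of_pairwise (by simpa using h)

/-- Whether an item is small, that is, packed by NFDH. -/
noncomputable def isSmall (s : ℝ) : Bool := decide (s ≤ 1 / 3)

/-- Whether an item is big, that is, packed by FFDS. -/
noncomputable def isBig (s : ℝ) : Bool := decide (1 / 3 < s)

theorem isBig_eq_not (s : ℝ) : isBig s = !isSmall s := by
  simp [isBig, isSmall, ← decide_not]

theorem length_NFDH_le_two {I G : List ℝ} (hI : IsInstance I) (hG : G ∈ groups I) :
    (NFDH (G.filter isSmall)).length ≤ 2 := by
  have h1 := (pairwise_of_mem_groups hG).sublist (List.filter_sublist (p := isSmall))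
  rw [NFDH, sortDown_of_pairwise h1]
  refine length_nextFitStart_le_two h1 (fun s hs => ?_)
    ((area_tail_filter_le _ _).trans (area_tail_le_one_of_mem_groups hG))
  have := List.mem_filter.1 hs
  exact ⟨(isInstance_of_mem_groups hI hG s this.1).1, by simpa [isSmall] using this.2⟩

theorem packSmall_eq (I : List ℝ) :
    packSmall I = (groups I).flatMap fun G => NFDH (G.filter isSmall) := rfl

/-- The number of small items of each group. -/
noncomputable def smallCounts (I : List ℝ) : List ℕ :=
  (groups I).map fun G => (G.filter isSmall).length

/-- The number of big items of each group. -/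
noncomputable def bigCounts (I : List ℝ) : List ℕ :=
  (groups I).map fun G => (G.filter isBig).length

theorem sum_map_length_NFDH (L : List ℝ) : ((NFDH L).map List.length).sum = L.length := by
  rw [← List.length_flatten, ← List.length_map PlacedSquare.size]
  exact (flatten_NFDH_perm L).length_eq

theorem countCost_le_of_length_le_two {l : List ℕ} (h : l.length ≤ 2) :
    countCost l ≤ 2 * l.sum := by
  rcases l with _ | ⟨a, _ | ⟨b, _ | ⟨c, l⟩⟩⟩
  · simp [countCost]
  · simp [countCost]; omega
  · simp [countCost]; omega
  · simp at h

/-- The items of the `j`-th group are packed in the first `2 * j` bins. -/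
theorem cost_packSmall_le {I : List ℝ} (hI : IsInstance I) :
    cost (packSmall I) ≤ 2 * countCost (smallCounts I) := by
  have key : ∀ gs : List (List ℝ), (∀ G ∈ gs, (NFDH (G.filter isSmall)).length ≤ 2) →
      countCost ((gs.flatMap fun G => NFDH (G.filter isSmall)).map List.length) ≤
        2 * countCost (gs.map fun G => (G.filter isSmall).length) ∧
      ((gs.flatMap fun G => NFDH (G.filter isSmall)).map List.length).sum =
        (gs.map fun G => (G.filter isSmall).length).sum := by
    intro gs h
    induction gs with
    | nil => simp [countCost]
    | cons G gs ih =>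
      obtain ⟨h1, h2⟩ := ih fun H hH => h H (by simp [hH])
      have h3 := h G (by simp)
      have h4 := sum_map_length_NFDH (G.filter isSmall)
      have h5 := countCost_le_of_length_le_two (l := (NFDH (G.filter isSmall)).map List.length)
        (by simpa using h3)
      simp only [List.flatMap_cons, List.map_append, List.map_cons, List.sum_append, List.sum_cons,
        countCost_append, List.length_map, countCost]
      rw [h2]
      refine ⟨?_, by rw [h4]⟩
      have h6 := Nat.mul_le_mul_right (gs.map fun G => (G.filter isSmall).length).sum h3
      omega
  rw [cost_eq_countCost]
  exact (key _ fun G hG => length_NFDH_le_two hI hG).1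

/-! ### Lower bounds on the cost by area -/

theorem area_take_cons_le {a : ℝ} {U : List ℝ} (h : (a :: U).Pairwise (· ≤ ·)) (ha : 0 ≤ a) (n : ℕ)
    (hn : n ≤ U.length) : area ((a :: U).take n) ≤ area (U.take n) := by
  induction U generalizing a n with
  | nil => obtain rfl : n = 0 := by simpa using hn
           simp
  | cons b U ih =>
    cases n with
    | zero => simp
    | succ n =>
      have hab : a ≤ b := List.rel_of_pairwise_cons h (by simp)
      have h1 := ih h.of_cons (ha.trans hab) n (by simpa using hn)
      have h2 : a ^ 2 ≤ b ^ 2 := by gcongr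
      rw [List.take_succ_cons, List.take_succ_cons, area_cons, area_cons]
      linarith

/-- The smallest `k` items have the smallest area among all selections of `k` items. -/
theorem area_take_le_of_sublist {T U : List ℝ} (hTU : T.Sublist U) (h : U.Pairwise (· ≤ ·))
    (h0 : ∀ s ∈ U, 0 ≤ s) : area (U.take T.length) ≤ area T := by
  induction hTU with
  | slnil => simp
  | @cons T U a hTU ih =>
    exact (area_take_cons_le h (h0 a (by simp)) _ hTU.length_le).trans
      (ih h.of_cons fun s hs => h0 s (by simp [hs]))
  | @cons_cons T U a hTU ih =>
    have := ih h.of_cons fun s hs => h0 s (by simp [hs])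
    simpa using this

theorem length_le_of_area_le {T U : List ℝ} (hTU : T.Subperm U) (h : U.Pairwise (· ≤ ·))
    (h0 : ∀ s ∈ U, 0 < s) {k : ℕ} (hk : area T ≤ area (U.take k)) : T.length ≤ k := by
  by_contra! hlt
  obtain ⟨T', hT', hsub⟩ := hTU
  have h1 := area_take_le_of_sublist hsub h fun s hs => (h0 s hs).le
  rw [hT'.length_eq, area_perm hT'] at h1
  have h2 : T.length ≤ U.length := hT'.length_eq ▸ hsub.length_le
  have h3 : U.take (k + 1) = U.take k ++ [U[k]] := by simp
  have h4 : area (U.take (k + 1)) ≤ area (U.take T.length) :=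
    area_le_of_sublist (List.take_sublist_take_left (by omega))
  have h5 := h0 U[k] (List.getElem_mem _)
  rw [h3, area_append] at h4
  simp only [area_cons, area_nil] at h4
  nlinarith

theorem area_flatten_le {Q : List (List ℝ)} (h : ∀ C ∈ Q, area C ≤ 1) :
    area Q.flatten ≤ Q.length := by
  induction Q with
  | nil => simp
  | cons C Q ih =>
    have h1 := ih fun D hD => h D (by simp [hD])
    have h2 := h C (by simp)
    simp only [List.flatten_cons, area_append, List.length_cons]
    push_cast
    linarith

theorem length_le_area_flatten {Q : List (List ℝ)} (h : ∀ C ∈ Q, 1 < area C) :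
    Q.length ≤ area Q.flatten := by
  induction Q with
  | nil => simp
  | cons C Q ih =>
    have h1 := ih fun D hD => h D (by simp [hD])
    have h2 := h C (by simp)
    simp only [List.flatten_cons, area_append, List.length_cons]
    push_cast
    linarith

theorem sum_take_map_length {α : Type*} (Q : List (List α)) (j : ℕ) :
    ((Q.map List.length).take j).sum = (Q.take j).flatten.length := by
  rw [← List.map_take, List.length_flatten]

/-- If consecutive groups of the sorted items have area at least `1` each, then no packing into
bins of area at most `1` is cheaper than placing the `j`-th group in the `j`-th bin: the first `j`
bins hold at most as many items as the first `j` groups. -/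
theorem countCost_groups_le {Hs Q : List (List ℝ)} (hsort : Hs.flatten.Pairwise (· ≤ ·))
    (hpos : ∀ s ∈ Hs.flatten, 0 < s) (hperm : Q.flatten.Perm Hs.flatten)
    (hQ : ∀ C ∈ Q, area C ≤ 1)
    (hH : ∀ j, (Hs.drop j).flatten = [] ∨ (j : ℝ) ≤ area (Hs.take j).flatten) :
    countCost (Hs.map List.length) ≤ countCost (Q.map List.length) := by
  refine countCost_le_of_take_sum_le (fun j => ?_) ?_
  · rw [sum_take_map_length, sum_take_map_length]
    have hsub : (Q.take j).flatten.Subperm Hs.flatten :=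
      ((List.take_sublist j Q).flatten.subperm).trans hperm.subperm
    have hsplit : (Hs.take j).flatten ++ (Hs.drop j).flatten = Hs.flatten := by
      rw [← List.flatten_append, List.take_append_drop]
    rcases hH j with h | h
    · rw [h, List.append_nil] at hsplit
      rw [hsplit]
      exact hsub.length_le
    · refine length_le_of_area_le hsub hsort hpos ?_
      rw [← hsplit, List.take_left]
      refine (area_flatten_le fun C hC => hQ C (List.mem_of_mem_take hC)).trans (le_trans ?_ h)
      exact_mod_cast (List.length_take_le _ _)
  · rw [← List.length_flatten, ← List.length_flatten]
    exact hperm.length_eq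

theorem drop_eq_nil_or_le_area (I : List ℝ) (j : ℕ) :
    (((groups I).map List.reverse).drop j).flatten = [] ∨
      (j : ℝ) ≤ area (((groups I).map List.reverse).take j).flatten := by
  rcases le_or_gt (groups I).length j with h | h
  · left
    rw [List.drop_eq_nil_of_le (by simpa using h), List.flatten_nil]
  · right
    have h1 : ∀ C ∈ ((groups I).map List.reverse).take j, 1 < area C := by
      intro C hC
      rw [← List.map_take] at hC
      obtain ⟨G, hG, rfl⟩ := List.mem_map.1 hC
      rw [area_perm (List.reverse_perm G)]
      refine one_lt_area_of_mem_dropLast [] (sortUp I) G ?_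
      change G ∈ (groups I).dropLast
      rw [List.dropLast_eq_take]
      exact (List.take_sublist_take_left (by omega)).subset hG
    have h2 := length_le_area_flatten h1
    rwa [List.length_take, List.length_map, Nat.min_eq_left h.le] at h2

theorem flatten_map_filter {α : Type*} (p : α → Bool) (Q : List (List α)) :
    (Q.map (List.filter p)).flatten = Q.flatten.filter p := List.filter_flatten.symm

/-- If one of the first `j` groups holds a big item, then there are no small items after them. -/
theorem drop_eq_nil_or_le_area_small (I : List ℝ) (j : ℕ) :
    ((((groups I).map List.reverse).map (List.filter isSmall)).drop j).flatten = [] ∨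
      (j : ℝ) ≤
        area ((((groups I).map List.reverse).map (List.filter isSmall)).take j).flatten := by
  have hsort := pairwise_sortUp I
  rw [← flatten_map_reverse_groups, ← List.take_append_drop j ((groups I).map List.reverse),
    List.flatten_append, List.pairwise_append] at hsort
  rw [← List.map_drop, ← List.map_take, flatten_map_filter, flatten_map_filter]
  by_cases h : ∀ s ∈ (((groups I).map List.reverse).take j).flatten, isSmall s
  · rw [List.filter_eq_self.2 h]
    refine (drop_eq_nil_or_le_area I j).imp_left fun h => ?_
    rw [h, List.filter_nil]
  · left
    push Not at h
    obtain ⟨s, hs, hs'⟩ := h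
    refine List.filter_eq_nil_iff.2 fun t ht ht' => hs' ?_
    have := hsort.2.2 s hs t ht
    simp only [isSmall, decide_eq_true_eq] at ht' ⊢
    linarith

theorem countCost_small_groups_le {I : List ℝ} (hI : IsInstance I) {Q : List (List ℝ)}
    (hperm : Q.flatten.Perm I) (hQ : ∀ C ∈ Q, area C ≤ 1) :
    countCost (smallCounts I) ≤ countCost (Q.map fun C => (C.filter isSmall).length) := by
  have e : (((groups I).map List.reverse).map (List.filter isSmall)).flatten
      = (sortUp I).filter isSmall := by
    rw [flatten_map_filter, flatten_map_reverse_groups]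
  have h1 := countCost_groups_le (Hs := ((groups I).map List.reverse).map (List.filter isSmall))
    (Q := Q.map (List.filter isSmall)) (by rw [e]; exact (pairwise_sortUp I).filter _)
    (by
      rw [e]
      exact fun s hs => (hI s ((sortUp_perm I).mem_iff.1 (List.mem_of_mem_filter hs))).1)
    (by rw [e, flatten_map_filter]; exact (hperm.trans (sortUp_perm I).symm).filter _)
    (by
      intro C hC
      obtain ⟨D, hD, rfl⟩ := List.mem_map.1 hC
      exact (area_le_of_sublist List.filter_sublist).trans (hQ D hD))
    (drop_eq_nil_or_le_area_small I)
  have e2 : (((groups I).map List.reverse).map (List.filter isSmall)).map List.length =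
      smallCounts I := by
    simp [smallCounts, Function.comp_def, List.filter_reverse]
  rw [e2, List.map_map] at h1
  exact h1

theorem length_filter_add (C : List ℝ) :
    (C.filter isSmall).length + (C.filter isBig).length = C.length := by
  rw [show isBig = fun s => !isSmall s from funext isBig_eq_not]
  exact (List.length_eq_length_filter_add _).symm

theorem countCost_all_groups_le {I : List ℝ} (hI : IsInstance I) {Q : List (List ℝ)}
    (hperm : Q.flatten.Perm I) (hQ : ∀ C ∈ Q, area C ≤ 1) :
    countCost (smallCounts I) + countCost (bigCounts I) ≤ countCost (Q.map List.length) := by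
  have e := flatten_map_reverse_groups I
  have h1 := countCost_groups_le (Hs := (groups I).map List.reverse) (Q := Q)
    (by rw [e]; exact pairwise_sortUp I)
    (by rw [e]; exact fun s hs => (hI s ((sortUp_perm I).mem_iff.1 hs)).1)
    (by rw [e]; exact hperm.trans (sortUp_perm I).symm) hQ (drop_eq_nil_or_le_area I)
  refine le_of_eq_of_le ?_ h1
  rw [smallCounts, bigCounts, ← countCost_map_add]
  simp [length_filter_add, Function.comp_def]

/-! ### The groups of small items precede the big items -/

/-- `gs₂` starts with the first group that holds a big item; only this group can hold both small and
big items. -/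
theorem exists_split_groups (I : List ℝ) : ∃ gs₁ gs₂ : List (List ℝ), groups I = gs₁ ++ gs₂ ∧
    (∀ G ∈ gs₁, ∀ s ∈ G, isSmall s) ∧
    ∀ G ∈ gs₂.tail, ∀ s ∈ G, isBig s := by
  have hsort := pairwise_sortUp I
  rw [← flatten_map_reverse_groups] at hsort
  generalize groups I = gs at *
  induction gs with
  | nil => exact ⟨[], [], by simp⟩
  | cons G gs ih =>
    rw [List.map_cons, List.flatten_cons, List.pairwise_append] at hsort
    by_cases hG : ∀ s ∈ G, isSmall s
    · obtain ⟨gs₁, gs₂, rfl, h1, h2⟩ := ih hsort.2.1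
      exact ⟨G :: gs₁, gs₂, rfl, by simpa using ⟨hG, h1⟩, h2⟩
    · refine ⟨[], G :: gs, rfl, by simp, fun H hH t ht => ?_⟩
      push Not at hG
      obtain ⟨s, hs, hs'⟩ := hG
      have := hsort.2.2 s (by simpa using hs) t
        (List.mem_flatten.2 ⟨H.reverse, List.mem_map_of_mem hH, by simpa using ht⟩)
      simp only [isSmall, isBig, ne_eq, decide_eq_true_eq, not_le] at hs' ⊢
      linarith

theorem length_filter_isBig_le {I G : List ℝ} (hG : G ∈ groups I) :
    (G.filter isBig).length ≤ 9 := by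
  have h1 := (area_tail_filter_le isBig G).trans (area_tail_le_one_of_mem_groups hG)
  cases h : G.filter isBig with
  | nil => simp
  | cons s T =>
    rw [h, List.tail_cons] at h1
    have h2 : ∀ t ∈ T, 1 / 3 < t := fun t ht => by
      have : t ∈ G.filter isBig := by simp [h, ht]
      simpa [isBig] using (List.mem_filter.1 this).2
    have h3 := length_mul_sq_le_area (by norm_num) fun t ht => (h2 t ht).le
    have h4 : (T.length : ℝ) ≤ 9 := by linarith
    have h4 : T.length ≤ 9 := by exact_mod_cast h4
    rcases Nat.lt_or_ge T.length 9 with h5 | h5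
    · simpa using h5
    · -- nine items greater than `1/3` have area more than `1`
      exfalso
      rcases T with _ | ⟨t, T⟩
      · simp at h5
      · have h6 := length_mul_sq_le_area (b := 1 / 3) (by norm_num)
          fun u hu => (h2 u (List.mem_cons_of_mem t hu)).le
        have h7 : (8 : ℝ) ≤ T.length := by
          have : 8 ≤ T.length := by simpa using h5
          exact_mod_cast this
        have h8 := h2 t (by simp)
        simp only [area_cons] at h1
        nlinarith

/-- If there are big items, then `r` is the number of groups of small items only. Each of these
groups has area more than `1`, hence at least ten items; at most one other group holds small items,
so that these occupy at most `2 * (r + 1)` bins; and the big items lie in groups of at most nine big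
items after the first `r` groups. Without big items, `r = 0` will do. -/
theorem exists_group_number {I : List ℝ} (hI : IsInstance I) : ∃ r : ℕ,
    (packSmall I).length * (I.filter isBig).length ≤ 2 * (r + 1) * (I.filter isBig).length ∧
    5 * (r * (r + 1)) ≤ countCost (smallCounts I) ∧
    18 * (r * (I.filter isBig).length) +
      (I.filter isBig).length * ((I.filter isBig).length + 1) ≤ 18 * countCost (bigCounts I) := by
  have hsumBig : (bigCounts I).sum = (I.filter isBig).length := by
    rw [← ((flatten_groups_perm I).filter isBig).length_eq, ← flatten_map_filter,
      List.length_flatten, bigCounts, List.map_map]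
    rfl
  rcases Nat.eq_zero_or_pos (I.filter isBig).length with h0 | h0
  · exact ⟨0, by simp [h0]⟩
  obtain ⟨gs₁, gs₂, hgs, h1, h2⟩ := exists_split_groups I
  have hbig1 : (gs₁.map fun G => (G.filter isBig).length).sum = 0 := by
    rw [List.sum_eq_zero_iff]
    intro x hx
    obtain ⟨G, hG, rfl⟩ := List.mem_map.1 hx
    rw [List.length_eq_zero_iff, List.filter_eq_nil_iff]
    intro s hs
    simp [isBig_eq_not, h1 G hG s hs]
  have hne : gs₂ ≠ [] := by
    rintro rfl
    rw [bigCounts, hgs, List.append_nil, hbig1] at hsumBig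
    omega
  have hbin : ∀ gs : List (List ℝ), (∀ G ∈ gs, G ∈ groups I) →
      (gs.flatMap fun G => NFDH (G.filter isSmall)).length ≤ 2 * gs.length := by
    intro gs h
    induction gs with
    | nil => simp
    | cons G gs ih =>
      have h3 := ih fun H hH => h H (by simp [hH])
      have h4 := length_NFDH_le_two hI (h G (by simp))
      simp only [List.flatMap_cons, List.length_append, List.length_cons]
      omega
  refine ⟨gs₁.length, ?_, ?_, ?_⟩
  · refine Nat.mul_le_mul_right _ ?_
    obtain ⟨G, gs₃, rfl⟩ := List.exists_cons_of_ne_nil hne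
    have h3 : gs₃.flatMap (fun G => NFDH (G.filter isSmall)) = [] := by
      rw [List.flatMap_eq_nil_iff]
      intro H hH
      have : H.filter isSmall = [] := by
        rw [List.filter_eq_nil_iff]
        intro s hs
        have := h2 H (by simpa using hH) s hs
        rw [isBig_eq_not] at this
        simpa using this
      rw [this]
      simp [NFDH, sortDown, nextFitStart]
    rw [packSmall_eq, hgs, List.flatMap_append, List.flatMap_cons, h3, List.append_nil]
    have h4 := hbin (gs₁ ++ [G]) (by rw [hgs]; simp; tauto)
    simpa [List.flatMap_append] using h4
  · have h3 : ∀ G ∈ gs₁, 10 ≤ (G.filter isSmall).length := by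
      intro G hG
      have hG' : G ∈ groups I := by rw [hgs]; simp [hG]
      have h4 : 1 < area G := by
        refine one_lt_area_of_mem_dropLast [] (sortUp I) G ?_
        change G ∈ (groups I).dropLast
        rw [hgs, List.dropLast_append_of_ne_nil hne]
        simp [hG]
      rw [List.filter_eq_self.2 (h1 G hG)]
      have h5 := area_le_length_mul_sq (L := G) (b := 1 / 3) fun s hs =>
        ⟨(isInstance_of_mem_groups hI hG' s hs).1, by simpa [isSmall] using h1 G hG s hs⟩
      have h6 : (9 : ℝ) < G.length := by linarith
      have h6 : 9 < G.length := by exact_mod_cast h6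
      omega
    have h4 : ∀ gs : List (List ℝ), (∀ G ∈ gs, 10 ≤ (G.filter isSmall).length) →
        10 * gs.length ≤ (gs.map fun G => (G.filter isSmall).length).sum ∧
        5 * (gs.length * (gs.length + 1)) ≤
          countCost (gs.map fun G => (G.filter isSmall).length) := by
      intro gs h
      induction gs with
      | nil => simp
      | cons G gs ih =>
        have h5 := ih fun H hH => h H (by simp [hH])
        have h6 := h G (by simp)
        simp only [List.map_cons, List.sum_cons, List.length_cons, countCost]
        refine ⟨by omega, ?_⟩
        nlinarith
    rw [smallCounts, hgs, List.map_append, countCost_append]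
    have := (h4 gs₁ h3).2
    omega
  · have h3 := hsumBig
    rw [bigCounts, hgs, List.map_append, List.sum_append, hbig1, zero_add] at h3
    rw [bigCounts, hgs, List.map_append, countCost_append, h3, List.length_map]
    have h4 := mul_succ_le_countCost (gs₂.map fun G => (G.filter isBig).length) (by
      intro x hx
      obtain ⟨G, hG, rfl⟩ := List.mem_map.1 hx
      exact length_filter_isBig_le (by rw [hgs]; simp [hG]))
    rw [h3] at h4
    linarith

/-! ### Optimality of First Fit Decreasing Size on the big items -/

/-- The numbers of items in the bins of FFDS are `4, …, 4, x, 1, …, 1` with `x ≤ 4`. With `M` medium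
items, `q` newly opened bins and `K` large items, the first `j` bins therefore hold
`min (4 * j) (M + j - q) (M + K)` items. -/
theorem exists_counts_ffdsLoop (Ls ms : List ℝ) : ∃ f : List ℕ,
    (((Timed.ffdsLoop Ls ms).val.1 ++ (Timed.ffdsLoop Ls ms).val.2).map List.length).Perm f ∧
    f.Pairwise (· ≥ ·) ∧ ∀ j n : ℕ, n ≤ 4 * j →
      n + (Timed.ffdsLoop Ls ms).val.2.length ≤ ms.length + j → n ≤ ms.length + Ls.length →
      n ≤ (f.take j).sum := by
  have le_four : ∀ (Ls ms : List ℝ) (f : List ℕ), (((Timed.ffdsLoop Ls ms).val.1 ++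
      (Timed.ffdsLoop Ls ms).val.2).map List.length).Perm f → ∀ x ∈ f, x ≤ 4 := by
    intro Ls ms f hf x hx
    obtain ⟨B, hB, rfl⟩ := List.mem_map.1 (hf.mem_iff.2 hx)
    exact Timed.length_le_four_of_mem_ffdsLoop Ls ms B hB
  have le_one : ∀ (Ls : List ℝ) (f : List ℕ), (((Timed.ffdsLoop Ls []).val.1 ++
      (Timed.ffdsLoop Ls []).val.2).map List.length).Perm f → ∀ x ∈ f, x ≤ 1 := by
    intro Ls f hf x hx
    rw [Timed.ffdsLoop_nil] at hf
    have := hf.mem_iff.2 hx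
    simp only [List.append_nil, List.map_map, List.mem_map] at this
    obtain ⟨s, -, rfl⟩ := this
    simp
  have le_head : ∀ (Ls ms : List ℝ) (k : ℕ) (f : List ℕ), 1 ≤ k → k ≤ 4 →
      (k < 4 → ms = []) → (((Timed.ffdsLoop Ls ms).val.1 ++
      (Timed.ffdsLoop Ls ms).val.2).map List.length).Perm f → ∀ x ∈ f, x ≤ k := by
    intro Ls ms k f h1 h2 h3 hf x hx
    rcases Nat.lt_or_ge k 4 with h | h
    · obtain rfl := h3 h
      exact (le_one Ls f hf x hx).trans h1
    · exact (le_four Ls ms f hf x hx).trans h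
  -- `f` follows the order in which the recursion fills the bins, and ends with the single items
  induction Ls, ms using ffds_induction with
  | nil Ls =>
    refine ⟨List.replicate Ls.length 1, ?_, by simp, ?_⟩
    · rw [Timed.ffdsLoop_nil]
      simp [Function.comp_def]
    · intro j n h1 h2 h3
      simp [Timed.ffdsLoop_nil] at h2 h3 ⊢
      omega
  | none m ms ih =>
    obtain ⟨f, hf, hs, hp⟩ := ih
    refine ⟨min 4 (ms.length + 1) :: f, ?_, ?_, ?_⟩
    · simp only [Timed.ffdsLoop_none, List.map_append, List.map_cons, length_fourCorners,
        List.length_cons] at hf ⊢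
      exact List.perm_middle.trans (hf.cons _)
    · exact hs.cons (le_head _ _ _ f (by omega) (by omega) (by
        intro h; exact List.drop_eq_nil_of_le (by omega)) hf)
    · intro j n h1 h2 h3
      cases j with
      | zero => omega
      | succ j =>
        have := hp j (n - min 4 (ms.length + 1))
        simp only [Timed.ffdsLoop_none, List.length_cons, List.length_drop, List.take_succ_cons,
          List.sum_cons, List.length_nil] at h2 h3 this ⊢
        omega
  | pair l Ls m ms h ih =>
    obtain ⟨f, hf, hs, hp⟩ := ih
    refine ⟨(min 3 (ms.length + 1) + 1) :: f, ?_, ?_, ?_⟩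
    · simp only [Timed.ffdsLoop_pair h, List.map_append, List.map_cons, length_threeCorners,
        List.length_cons, List.cons_append] at hf ⊢
      exact hf.cons _
    · exact hs.cons (le_head _ _ _ f (by omega) (by omega) (by
        intro h; exact List.drop_eq_nil_of_le (by omega)) hf)
    · intro j n h1 h2 h3
      cases j with
      | zero => omega
      | succ j =>
        have := hp j (n - (min 3 (ms.length + 1) + 1))
        have hq : ms.length ≤ 2 → (Timed.ffdsLoop Ls (ms.drop 2)).val.2.length = 0 := by
          intro h
          rw [List.drop_eq_nil_of_le h, Timed.ffdsLoop_nil]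
          rfl
        simp only [Timed.ffdsLoop_pair h, List.length_cons, List.length_drop, List.take_succ_cons,
          List.sum_cons] at h2 h3 this ⊢
        omega
  | skip l Ls m ms h ih =>
    obtain ⟨f, hf, hs, hp⟩ := ih
    refine ⟨min 4 (ms.length + 1) :: f, ?_, ?_, ?_⟩
    · simp only [Timed.ffdsLoop_skip h, List.map_append, List.map_cons, length_fourCorners,
        List.length_cons] at hf ⊢
      exact List.perm_middle.trans (hf.cons _)
    · exact hs.cons (le_head _ _ _ f (by omega) (by omega) (by
        intro h; exact List.drop_eq_nil_of_le (by omega)) hf)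
    · intro j n h1 h2 h3
      cases j with
      | zero => omega
      | succ j =>
        have := hp j (n - min 4 (ms.length + 1))
        have hq : ms.length ≤ 3 → (Timed.ffdsLoop (l :: Ls) (ms.drop 3)).val.2.length = 0 := by
          intro h
          rw [List.drop_eq_nil_of_le h, Timed.ffdsLoop_nil]
          rfl
        simp only [Timed.ffdsLoop_skip h, List.length_cons, List.length_drop, List.take_succ_cons,
          List.sum_cons] at h2 h3 this ⊢
        omega

theorem countP_drop_of_pairwise {ms : List ℝ} (h : ms.Pairwise (· ≥ ·)) (μ : ℝ) (k : ℕ)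
    (hk : 0 < (ms.drop k).countP fun m => decide (μ ≤ m)) :
    ms.countP (fun m => decide (μ ≤ m)) = k + (ms.drop k).countP fun m => decide (μ ≤ m) := by
  obtain ⟨z, hz, hμz⟩ := List.countP_pos_iff.1 hk
  rw [decide_eq_true_eq] at hμz
  have hlen : k < ms.length := by
    by_contra! hge
    simp [List.drop_eq_nil_of_le hge] at hz
  conv_lhs => rw [← List.take_append_drop k ms]
  rw [← List.take_append_drop k ms, List.pairwise_append] at h
  rw [List.countP_append, List.countP_eq_length.2, List.length_take, Nat.min_eq_left hlen.le]
  intro a ha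
  rw [decide_eq_true_eq]
  exact hμz.trans (h.2.2 a ha z hz)

/-- When FFDS opens the last one of its `q` new bins, the first remaining medium item `μ` fits next
to none of the large items that are still alone, so that at most the `p` large items used before
have size at most `1 - μ`. By then `3 * p + 4 * (q - 1)` medium items have been packed, all of size
at least `μ`, and `μ` itself is one more. -/
theorem exists_threshold_ffdsLoop (Ls ms : List ℝ) (hLs : Ls.Pairwise (· ≤ ·))
    (hms : ms.Pairwise (· ≥ ·)) : (Timed.ffdsLoop Ls ms).val.2.length = 0 ∨
    ∃ μ : ℝ, 3 * (Ls.countP fun l => decide (l + μ ≤ 1)) +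
      4 * (Timed.ffdsLoop Ls ms).val.2.length ≤ (ms.countP fun m => decide (μ ≤ m)) + 3 := by
  induction Ls, ms using ffds_induction with
  | nil Ls => left; simp [Timed.ffdsLoop_nil]
  | none m ms ih =>
    right
    rw [Timed.ffdsLoop_none, List.length_cons]
    rcases Nat.eq_zero_or_pos (Timed.ffdsLoop [] (ms.drop 3)).val.2.length with h0 | h0
    · exact ⟨m, by simp [h0]⟩
    rcases ih hLs (hms.of_cons.sublist (List.drop_sublist _ _)) with h | ⟨μ, hμ⟩
    · omega
    · refine ⟨μ, ?_⟩
      have := countP_drop_of_pairwise hms μ 4 (by rw [List.drop_succ_cons]; omega)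
      rw [List.drop_succ_cons] at this
      omega
  | pair l Ls m ms h ih =>
    simp only [Timed.ffdsLoop_pair h]
    rcases Nat.eq_zero_or_pos (Timed.ffdsLoop Ls (ms.drop 2)).val.2.length with h0 | h0
    · exact Or.inl h0
    rcases ih hLs.of_cons (hms.of_cons.sublist (List.drop_sublist _ _)) with h | ⟨μ, hμ⟩
    · exact Or.inl h
    · refine Or.inr ⟨μ, ?_⟩
      have := countP_drop_of_pairwise hms μ 3 (by rw [List.drop_succ_cons]; omega)
      rw [List.drop_succ_cons] at this
      rw [List.countP_cons]
      split_ifs <;> omega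
  | skip l Ls m ms h ih =>
    right
    rw [Timed.ffdsLoop_skip h, List.length_cons]
    rcases Nat.eq_zero_or_pos (Timed.ffdsLoop (l :: Ls) (ms.drop 3)).val.2.length with h0 | h0
    · refine ⟨m, ?_⟩
      have h1 : (l :: Ls).countP (fun l => decide (l + m ≤ 1)) = 0 := by
        rw [List.countP_eq_zero]
        intro x hx
        have : l ≤ x := by
          rcases List.mem_cons.1 hx with rfl | hx
          · exact le_rfl
          · exact List.rel_of_pairwise_cons hLs hx
        rw [decide_eq_true_eq]
        linarith
      rw [h1, h0]
      simp
    rcases ih hLs (hms.of_cons.sublist (List.drop_sublist _ _)) with h | ⟨μ, hμ⟩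
    · omega
    · refine ⟨μ, ?_⟩
      have := countP_drop_of_pairwise hms μ 4 (by rw [List.drop_succ_cons]; omega)
      rw [List.drop_succ_cons] at this
      omega

/-- A bin with a large item has no other large item; and if it holds a medium item of size at least
`μ`, then the large item has size at most `1 - μ`, and there are at most three such items. -/
theorem bin_bounds {C : List ℝ} (hlen : C.length ≤ 4) (hC : C.Pairwise fun a b => a + b ≤ 1)
    (μ : ℝ) : C.countP (fun s => decide (1 / 2 < s)) ≤ 1 ∧
    C.countP (fun s => decide (s ≤ 1 / 2 ∧ μ ≤ s)) + 4 * C.countP (fun s => decide (1 / 2 < s)) ≤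
      4 + 3 * C.countP fun s => decide (1 / 2 < s ∧ s + μ ≤ 1) := by
  classical
  by_cases h : ∃ l ∈ C, 1 / 2 < l
  · obtain ⟨l, hl, hl2⟩ := h
    have hperm := List.perm_cons_erase hl
    rw [hperm.pairwise_iff (fun h => by linarith)] at hC
    rw [hperm.length_eq] at hlen
    rw [hperm.countP_eq, hperm.countP_eq, hperm.countP_eq]
    generalize C.erase l = D at *
    rw [List.length_cons] at hlen
    have hD : ∀ x ∈ D, l + x ≤ 1 := fun x hx => List.rel_of_pairwise_cons hC hx
    have h1 : D.countP (fun s => decide (1 / 2 < s)) = 0 := by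
      rw [List.countP_eq_zero]
      intro x hx
      have := hD x hx
      rw [decide_eq_true_eq]
      linarith
    have h2 : D.countP (fun s => decide (s ≤ 1 / 2 ∧ μ ≤ s)) ≤ D.length := List.countP_le_length
    simp only [List.countP_cons, h1, decide_eq_true_eq, hl2, not_le.2 hl2, true_and, false_and,
      if_true, if_false]
    refine ⟨le_rfl, ?_⟩
    by_cases h3 : l + μ ≤ 1
    · simp only [h3, if_true]
      omega
    · have h4 : D.countP (fun s => decide (s ≤ 1 / 2 ∧ μ ≤ s)) = 0 := by
        rw [List.countP_eq_zero]
        intro x hx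
        have := hD x hx
        rw [decide_eq_true_eq]
        rintro ⟨-, h⟩
        exact h3 (by linarith)
      omega
  · push Not at h
    have h1 : C.countP (fun s => decide (1 / 2 < s)) = 0 := by
      rw [List.countP_eq_zero]
      intro x hx
      have := h x hx
      rw [decide_eq_true_eq]
      linarith
    have h2 : C.countP (fun s => decide (s ≤ 1 / 2 ∧ μ ≤ s)) ≤ C.length := List.countP_le_length
    omega

theorem bins_bounds {T : List (List ℝ)} (hlen : ∀ C ∈ T, C.length ≤ 4)
    (hC : ∀ C ∈ T, C.Pairwise fun a b => a + b ≤ 1) (μ : ℝ) :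
    T.flatten.length ≤ 4 * T.length ∧
    T.flatten.countP (fun s => decide (1 / 2 < s)) ≤ T.length ∧
    T.flatten.countP (fun s => decide (s ≤ 1 / 2 ∧ μ ≤ s)) +
        4 * T.flatten.countP (fun s => decide (1 / 2 < s)) ≤
      4 * T.length + 3 * T.flatten.countP fun s => decide (1 / 2 < s ∧ s + μ ≤ 1) := by
  induction T with
  | nil => simp
  | cons C T ih =>
    have h1 := ih (fun D hD => hlen D (by simp [hD])) fun D hD => hC D (by simp [hD])
    have h2 := bin_bounds (hlen C (by simp)) (hC C (by simp)) μ
    have h3 := hlen C (by simp)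
    simp only [List.flatten_cons, List.countP_append, List.length_append, List.length_cons]
    omega

theorem countP_subperm {T U : List ℝ} (h : T.Subperm U) (p : ℝ → Bool) :
    T.countP p ≤ U.countP p := by
  obtain ⟨T', hT', hsub⟩ := h
  rw [← hT'.countP_eq]
  exact hsub.countP_le

theorem countP_half_split (T : List ℝ) (μ : ℝ) :
    T.countP (fun s => decide (s ≤ 1 / 2 ∧ μ ≤ s)) + T.countP (fun s => decide (s ≤ 1 / 2 ∧ s < μ))
      + T.countP (fun s => decide (1 / 2 < s)) = T.length := by
  induction T with
  | nil => simp
  | cons s T ih =>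
    simp only [List.countP_cons, List.length_cons, decide_eq_true_eq]
    rcases le_or_gt s (1 / 2) with h1 | h1 <;> rcases le_or_gt μ s with h2 | h2 <;>
      simp only [h1, h2, not_lt.2, not_le.2, and_true, and_false, if_true, if_false] <;> omega

/-- The first `j` bins of FFDS hold at least as many items as the first `j` bins of any other
packing, for all `j`. Let there be `M` medium items, and let FFDS open `q` new bins. If `j` bins of
a packing include at least `q` bins without a large item, then they hold at most `j - q` large items
and thus at most `M + (j - q)` items. If they include only `c < q` bins without a large item, then
at least `q - c` medium items are missing from the `j` bins, since the medium items of size at least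
the threshold `μ` fit only into these `c` bins and next to the large items of size at most
`1 - μ`. -/
theorem cost_FFDS_le {L : List ℝ} {Q : List (List ℝ)} (hperm : Q.flatten.Perm L)
    (hlen : ∀ C ∈ Q, C.length ≤ 4) (hC : ∀ C ∈ Q, C.Pairwise fun a b => a + b ≤ 1) :
    cost (sortByCount (FFDS L)) ≤ countCost (Q.map List.length) := by
  have hLs := sortUp_perm (L.filter fun s => decide (1 / 2 < s))
  have hms := sortDown_perm (L.filter fun s => decide (s ≤ 1 / 2))
  have hLs1 := pairwise_sortUp (L.filter fun s => decide (1 / 2 < s))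
  have hms1 := pairwise_sortDown (L.filter fun s => decide (s ≤ 1 / 2))
  have hL := (hLs.append hms).trans (filter_append_filter_not_perm L _)
  have hFF := FFDS_eq L
  have hLs2 : ∀ s ∈ sortUp (L.filter fun s => decide (1 / 2 < s)), 1 / 2 < s := fun s hs => by
    simpa using (List.mem_filter.1 (hLs.mem_iff.1 hs)).2
  have hms2 : ∀ s ∈ sortDown (L.filter fun s => decide (s ≤ 1 / 2)), s ≤ 1 / 2 := fun s hs => by
    simpa using (List.mem_filter.1 (hms.mem_iff.1 hs)).2
  generalize sortUp (L.filter fun s => decide (1 / 2 < s)) = Ls at *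
  generalize sortDown (L.filter fun s => decide (s ≤ 1 / 2)) = ms at *
  obtain ⟨f, hf, hfs, hfp⟩ := exists_counts_ffdsLoop Ls ms
  rw [← hFF] at hf
  have hsorted : ((sortByCount (FFDS L)).map List.length).Pairwise (· ≥ ·) := by
    rw [List.pairwise_map]
    have := List.pairwise_mergeSort (le := fun B B' : Bin => decide (B'.length ≤ B.length))
      (by simp only [decide_eq_true_eq]; exact fun a b c h1 h2 => le_trans h2 h1)
      (by simpa using fun a b => le_total _ _) (FFDS L)
    simpa [sortByCount] using this
  have hfe : (sortByCount (FFDS L)).map List.length = f :=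
    (((sortByCount_perm _).map _).trans hf).eq_of_pairwise
      (fun a b _ _ h1 h2 => le_antisymm h2 h1) hsorted hfs
  have hQL := hperm.trans hL.symm
  rw [cost_eq_countCost, hfe]
  refine countCost_le_of_take_sum_le (fun j => ?_) ?_
  · rw [sum_take_map_length]
    have hT : ∀ C ∈ Q.take j, C ∈ Q := fun C => List.mem_of_mem_take
    have hsub : (Q.take j).flatten.Subperm (Ls ++ ms) :=
      ((List.take_sublist j Q).flatten.subperm).trans hQL.subperm
    have hj : (Q.take j).length ≤ j := List.length_take_le _ _
    generalize Q.take j = T at *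
    have hb := fun μ => bins_bounds (fun C h => hlen C (hT C h)) (fun C h => hC C (hT C h)) μ
    refine hfp j _ (by have := (hb 0).1; omega) ?_ (by simpa [add_comm] using hsub.length_le)
    have hlarge : (Ls ++ ms).countP (fun s => decide (1 / 2 < s)) = Ls.length := by
      rw [List.countP_append, List.countP_eq_length.2, List.countP_eq_zero.2, add_zero]
      · intro s hs; simpa using hms2 s hs
      · intro s hs; simpa using hLs2 s hs
    rcases exists_threshold_ffdsLoop Ls ms hLs1 hms1 with h | ⟨μ, hμ⟩
    · rw [h]
      have h1 := countP_half_split T.flatten 0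
      have h2 := countP_half_split (Ls ++ ms) 0
      have h3 := countP_subperm hsub fun s => decide (s ≤ 1 / 2 ∧ 0 ≤ s)
      have h4 := countP_subperm hsub fun s => decide (s ≤ 1 / 2 ∧ s < 0)
      have h5 := (hb 0).2.1
      rw [List.length_append] at h2
      omega
    · have h1 := countP_half_split T.flatten μ
      have h2 := countP_half_split (Ls ++ ms) μ
      have h3 := countP_subperm hsub fun s => decide (s ≤ 1 / 2 ∧ μ ≤ s)
      have h4 := countP_subperm hsub fun s => decide (s ≤ 1 / 2 ∧ s < μ)
      have h5 := (hb μ).2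
      have h6 := countP_subperm hsub fun s => decide (1 / 2 < s ∧ s + μ ≤ 1)
      have h7 : (Ls ++ ms).countP (fun s => decide (1 / 2 < s ∧ s + μ ≤ 1)) =
          Ls.countP fun l => decide (l + μ ≤ 1) := by
        rw [List.countP_append, (List.countP_eq_zero (l := ms)).2, add_zero]
        · refine List.countP_congr fun s hs => ?_
          simp [(by simpa using hLs2 s hs : (2 : ℝ)⁻¹ < s)]
        · intro s hs
          have := hms2 s hs
          rw [decide_eq_true_eq]
          rintro ⟨h, -⟩
          linarith
      have h8 : (Ls ++ ms).countP (fun s => decide (s ≤ 1 / 2 ∧ μ ≤ s)) =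
          ms.countP fun m => decide (μ ≤ m) := by
        rw [List.countP_append, (List.countP_eq_zero (l := Ls)).2, zero_add]
        · refine List.countP_congr fun s hs => ?_
          simp [(by simpa using hms2 s hs : s ≤ (2 : ℝ)⁻¹)]
        · intro s hs
          have := hLs2 s hs
          rw [decide_eq_true_eq]
          rintro ⟨h, -⟩
          linarith
      rw [List.length_append] at h2
      omega
  · have h1 := (ffdsLoop_perm Ls ms).length_eq
    rw [List.length_map, ← hFF, ← hQL.length_eq] at h1
    rw [← List.length_flatten, hf.symm.sum_eq, ← List.length_flatten, h1]

/-! ### The approximation ratio -/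

/-- A packing pays at least the cost of the groups, and at least the cost of the groups of small
items and the cost of FFDS. -/
theorem lower_bounds {I : List ℝ} (hI : IsInstance I) {P : List Bin} (hP : IsPacking I P) :
    countCost (smallCounts I) + countCost (bigCounts I) ≤ cost P ∧
    countCost (smallCounts I) + cost (sortByCount (FFDS (I.filter isBig))) ≤ cost P := by
  have hpos : ∀ B ∈ P, ∀ p ∈ B, 0 < p.size := fun B hB p hp =>
    (hI p.size (hP.2.mem_iff.1 (List.mem_map_of_mem (List.mem_flatten.2 ⟨B, hB, hp⟩)))).1
  set Q : List (List ℝ) := P.map (List.map PlacedSquare.size) with hQdef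
  have hQ : Q.flatten.Perm I := by rw [hQdef, ← List.map_flatten]; exact hP.2
  have harea : ∀ C ∈ Q, area C ≤ 1 := by
    intro C hC
    obtain ⟨B, hB, rfl⟩ := List.mem_map.1 hC
    exact area_le_one_of_feasibleBin (hP.1 B hB) (hpos B hB)
  have hcost : cost P = countCost (Q.map List.length) := by
    rw [cost_eq_countCost, hQdef, List.map_map]
    congr 1
    exact List.map_congr_left fun B _ => by simp
  have hsplit : countCost (Q.map List.length) =
      countCost (Q.map fun C => (C.filter isSmall).length) +
        countCost (Q.map fun C => (C.filter isBig).length) := by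
    rw [← countCost_map_add]
    simp only [length_filter_add]
  have hbig : ∀ C ∈ Q.map (List.filter isBig), ∃ B : Bin, FeasibleBin B ∧
      (∀ p ∈ B, 1 / 3 < p.size) ∧ C = B.map PlacedSquare.size := by
    intro C hC
    rw [hQdef, List.map_map] at hC
    obtain ⟨B, hB, rfl⟩ := List.mem_map.1 hC
    refine ⟨B.filter (isBig ∘ PlacedSquare.size), (hP.1 B hB).sublist List.filter_sublist, ?_, ?_⟩
    · intro p hp
      simpa [isBig] using (List.mem_filter.1 hp).2
    · exact List.filter_map
  have h2 := cost_FFDS_le (L := I.filter isBig) (Q := Q.map (List.filter isBig))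
    (by rw [flatten_map_filter]; exact hQ.filter _)
    (by
      intro C hC
      obtain ⟨B, h3, h4, rfl⟩ := hbig C hC
      simpa using length_le_four_of_feasibleBin h3 h4)
    (by
      intro C hC
      obtain ⟨B, h3, h4, rfl⟩ := hbig C hC
      rw [List.pairwise_map]
      exact pairwise_size_add_size_le h3 fun p hp => by linarith [h4 p hp])
  rw [List.map_map] at h2
  rw [hcost]
  refine ⟨countCost_all_groups_le hI hQ harea, ?_⟩
  rw [hsplit]
  exact Nat.add_le_add (countCost_small_groups_le hI hQ harea) h2

theorem cost_algorithm_le {I : List ℝ} (hI : IsInstance I) : cost (algorithm I) ≤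
    2 * countCost (smallCounts I) + (packSmall I).length * (I.filter isBig).length +
      cost (sortByCount (FFDS (I.filter isBig))) := by
  have h1 := cost_packSmall_le hI
  have h2 := (isPacking_FFDS (hI.filter isBig)).sortByCount.2.length_eq
  rw [List.length_map, List.length_flatten] at h2
  have h3 : algorithm I = packSmall I ++ sortByCount (FFDS (I.filter isBig)) := rfl
  rw [cost_eq_countCost] at h1
  rw [h3, cost_eq_countCost, List.map_append, countCost_append, h2, List.length_map,
    cost_eq_countCost]
  omega

theorem sum_smallCounts (I : List ℝ) : (smallCounts I).sum = (I.filter isSmall).length := by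
  rw [← ((flatten_groups_perm I).filter isSmall).length_eq, ← flatten_map_filter,
    List.length_flatten, smallCounts, List.map_map]
  rfl

/-- The inequality behind the approximation ratio. Here `N` and `L` are the numbers of small and big
items, `S` and `D` the costs of the small and the big items when the `j`-th group is placed in the
`j`-th bin, `F` is the cost of FFDS and `r` the number of groups of small items only. The lower
bound `S + D` is used with weight `31/22` and the lower bound `S + F` with weight `1`. -/
theorem ratio_inequality {N L S D F r OPT : ℝ} (hL : L = 0 ∨ 1 ≤ L) (hr : 0 ≤ r)
    (hn : 266730 ≤ N + L) (hSN : N ≤ S) (hSr : 5 * (r * (r + 1)) ≤ S)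
    (hD : 18 * (r * L) + L * (L + 1) ≤ 18 * D) (h1 : S + D ≤ OPT) (h2 : S + F ≤ OPT) :
    2 * S + 2 * (r + 1) * L + F < 53 / 22 * OPT := by
  suffices h : 0 < 9 / 22 * S - 13 / 22 * (r * L) + 31 / 396 * (L * (L + 1)) - 2 * L by
    linarith
  have hL0 : 0 ≤ L := by rcases hL with h | h <;> linarith
  rcases le_or_gt 54 L with h | h
  · -- the form `45/22 * r ^ 2 - 13/22 * r * L + 31/396 * L ^ 2` is positive definite
    nlinarith [sq_nonneg (r - 13 / 90 * L)]
  · -- few big items: already the small items outweigh their cost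
    have h3 : r * L ≤ r * 54 := by gcongr
    nlinarith [sq_nonneg (r - 16)]

theorem cost_algorithm_lt {I : List ℝ} (hI : IsInstance I) (hn : 266730 ≤ I.length) :
    (cost (algorithm I) : ℝ) < 53 / 22 * (OPT I : ℝ) := by
  obtain ⟨P, hP, hcost⟩ : OPT I ∈ {c : ℕ | ∃ P : List Bin, IsPacking I P ∧ cost P = c} :=
    Nat.sInf_mem ⟨_, algorithm I, isPacking_algorithm hI, rfl⟩
  obtain ⟨h1, h2⟩ := lower_bounds hI hP
  rw [hcost] at h1 h2
  obtain ⟨r, h3, h4, h5⟩ := exists_group_number hI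
  have h6 := cost_algorithm_le hI
  have h7 := sum_le_countCost (smallCounts I)
  rw [sum_smallCounts] at h7
  have h8 := length_filter_add I
  generalize (I.filter isSmall).length = N at *
  generalize (I.filter isBig).length = L at *
  generalize countCost (smallCounts I) = S at *
  generalize countCost (bigCounts I) = D at *
  generalize cost (sortByCount (FFDS (I.filter isBig))) = F at *
  have h9 : cost (algorithm I) ≤ 2 * S + 2 * (r + 1) * L + F := by omega
  have h10 : (cost (algorithm I) : ℝ) ≤ 2 * S + 2 * (r + 1) * L + F := by exact_mod_cast h9
  refine h10.trans_lt (ratio_inequality (N := N) (D := D) ?_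
    (Nat.cast_nonneg r) ?_ ?_ ?_ ?_ ?_ ?_)
  · rcases Nat.eq_zero_or_pos L with h | h
    · left; exact_mod_cast h
    · right; exact_mod_cast h
  · exact_mod_cast (h8 ▸ hn)
  · exact_mod_cast h7
  · exact_mod_cast h4
  · exact_mod_cast h5
  · exact_mod_cast h1
  · exact_mod_cast h2

end SquareMinSum

theorem mainTheorem1 :
    (∀ I : List ℝ, SquareMinSum.IsInstance I →
      SquareMinSum.IsPacking I (SquareMinSum.algorithm I)) ∧
    (∀ I : List ℝ, SquareMinSum.IsInstance I → 266730 ≤ I.length →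
      (SquareMinSum.cost (SquareMinSum.algorithm I) : ℝ) < 53 / 22 * (SquareMinSum.OPT I : ℝ)) ∧
    (∀ I : List ℝ, SquareMinSum.IsInstance I →
      (SquareMinSum.Timed.algorithm I).val = SquareMinSum.algorithm I) ∧
    (∃ C : ℝ, ∀ I : List ℝ, SquareMinSum.IsInstance I → 2 ≤ I.length →
      ((SquareMinSum.Timed.algorithm I).steps : ℝ) ≤
        C * ((I.length : ℝ) * Real.log (I.length : ℝ))) :=
  ⟨fun _ hI => SquareMinSum.isPacking_algorithm hI,
    fun _ hI hn => SquareMinSum.cost_algorithm_lt hI hn,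
    fun I _ => SquareMinSum.Timed.algorithm_val I,
    let ⟨C, hC⟩ := SquareMinSum.Timed.exists_steps_le
    ⟨C, fun I _ hI => hC I hI⟩⟩
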